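/- **Theorem 2.3.** Let $X,U,V$ be (real) Hilbert spaces, let $A:D(A)\subset X\to X$ be the generator of a $C_0$ semigroup $(S(t))_{t\ge 0}$ on $X$, let $B\in L(U,X)$ and $C\in L(X,V)$ be bounded operators, and let $Q\in L(U,U)$ be an invertible positive definite self-adjoint operator. Let $y_d\in X$ and $u_d\in U$. A pair $(A,B)$ is called exponentially stabilizable if there is $K\in L(X,U)$ such that $A+BK$ (with domain $D(A)$) generates a $C_0$ semigroup $(S_K(t))_{t\geq 0}$ with $\|S_K(t)\|\le M e^{-\omega t}$ for all $t\ge 0$, for some $M,\omega>0$; the pair $(A,C)$ is called exponentially detectable if $(A^*,C^*)$ is exponentially stabilizable. For $T>0$ and $y_0\in X$, let $(LQ^T)$ be the problem of minimizing $$\frac12\int_0^T\Big(\|C(y(t)-y_d)\|_V^2+\|Q^{1/2}(u(t)-u_d)\|_U^2\Big)\,dt$$ over all $u\in L^2(0,T;U)$, where $y\in C([0,T];X)$ is the mild solution of $\dot y=Ay+Bu$, $y(0)=y_0$, that is, $y(t)=S(t)y_0+\int_0^tS(t-s)Bu(s)\,ds$. An optimal triple of $(LQ^T)$ is a triple $(y^T,\lambda^T,u^T)$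 where $(y^T,u^T)$ is an optimal pair of $(LQ^T)$ and $\lambda^T\in C([0,T];X)$ is its adjoint state, that is, the mild solution of $\dot\lambda^T=C^*Cy^T-A^*\lambda^T-C^*Cy_d$, $\lambda^T(T)=0$: $\lambda^T(t)=-\int_t^TS(s-t)^*C^*C(y^T(s)-y_d)\,ds$. Let $(P_s)$ be the problem of minimizing $\frac12\big(\|C(y-y_d)\|_V^2+\|Q^{1/2}(u-u_d)\|_U^2\big)$ over all $(y,u)\in D(A)\times U$ with $Ay+Bu=0$. An optimal steady-state triple is a triple $(y_s,\lambda_s,u_s)$ where $(y_s,u_s)$ is an optimal pair of $(P_s)$ and $\lambda_s\in D(A^*)$ satisfies $C^*Cy_s-A^*\lambda_s-C^*Cy_d=0$ and $u_s=u_d+Q^{-1}B^*\lambda_s$. Assume that $(A,B)$ is exponentially stabilizable and that $(A,C)$ is exponentially detectable. Then there exist constants $c>0$ and $\nu>0$, not depending on $T$ nor on $y_0$, such that, for every optimal steady-state triple $(y_s,\lambda_s,u_s)$, every $y_0\in X$, every $T>0$ and every optimal triple $(y^T,\lambda^T,u^T)$ of $(LQ^T)$, $$\|y^T(t)-y_s\|_X+\|\lambda^T(t)-\lambda_s\|_X+\|u^T(t)-u_s\|_U\le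 c\,\big(\|y_0-y_s\|_X+\|\lambda_s\|_X\big)\big(e^{-\nu t}+e^{-\nu(T-t)}\big)$$ for almost every $t\in[0,T]$. -/

import Mathlib

open MeasureTheory Set Filter Topology

namespace LQTurnpike

variable {X U V : Type*}
  [NormedAddCommGroup X] [InnerProductSpace ℝ X] [CompleteSpace X]
  [NormedAddCommGroup U] [InnerProductSpace ℝ U] [CompleteSpace U]
  [NormedAddCommGroup V] [InnerProductSpace ℝ V] [CompleteSpace V]

/-- `(S t)_{t ≥ 0}` is a `C₀` semigroup of bounded operators on `X`; the values of `S` at negative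
times are irrelevant. -/
structure IsC0Semigroup (S : ℝ → X →L[ℝ] X) : Prop where
  map_zero : S 0 = ContinuousLinearMap.id ℝ X
  map_add : ∀ s t : ℝ, 0 ≤ s → 0 ≤ t → S (s + t) = (S s).comp (S t)
  strongly_continuous : ∀ x : X, Tendsto (fun t : ℝ => S t x) (𝓝[>] 0) (𝓝 x)

/-- The (possibly unbounded) operator `A : D(A) ⊂ X → X` is the infinitesimal generator of the
`C₀` semigroup `S`: `x ∈ D(A)` with `A x = z` if and only if `(S h x - x) / h → z` as `h → 0⁺`. -/
structure Generates (A : X →ₗ.[ℝ] X) (S : ℝ → X →L[ℝ] X) : Prop where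
  isC0Semigroup : IsC0Semigroup S
  mem_graph_iff : ∀ x z : X,
    (x, z) ∈ A.graph ↔ Tendsto (fun h : ℝ => h⁻¹ • (S h x - x)) (𝓝[>] 0) (𝓝 z)

/-- `A` generates a `C₀` semigroup `S` with `‖S t‖ ≤ c e^{-ν t}` for all `t ≥ 0`. -/
def ExponentiallyStable (A : X →ₗ.[ℝ] X) : Prop :=
  ∃ S : ℝ → X →L[ℝ] X, Generates A S ∧
    ∃ c ν : ℝ, 0 < c ∧ 0 < ν ∧ ∀ t : ℝ, 0 ≤ t → ‖S t‖ ≤ c * Real.exp (-ν * t)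

/-- `(A, B)` is exponentially stabilizable: for some `K ∈ L(X, U)`, the operator `A + B K`, with
domain `D(A)`, is exponentially stable. -/
def ExponentiallyStabilizable (A : X →ₗ.[ℝ] X) (B : U →L[ℝ] X) : Prop :=
  ∃ K : X →L[ℝ] U, ExponentiallyStable ((B.comp K : X →ₗ[ℝ] X) +ᵥ A)

/-- `(A, C)` is exponentially detectable: `(A*, C*)` is exponentially stabilizable. -/
def ExponentiallyDetectable (A : X →ₗ.[ℝ] X) (C : X →L[ℝ] V) : Prop :=
  ExponentiallyStabilizable A.adjoint C.adjoint

/-- `y ∈ C([0,T]; X)` is the mild solution of `y' = A y + f`, `y(0) = y₀` on `[0,T]`, where `A`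
generates the semigroup `S`. -/
def IsMildSolution (S : ℝ → X →L[ℝ] X) (f : ℝ → X) (y₀ : X) (T : ℝ) (y : ℝ → X) : Prop :=
  ContinuousOn y (Icc 0 T) ∧
    ∀ t ∈ Icc 0 T, y t = S t y₀ + ∫ s in (0 : ℝ)..t, S (t - s) (f s)

/-- `l ∈ C([0,T]; X)` is the mild solution of the backward equation `l' = -A* l + g`, `l(T) = l₁`
on `[0,T]`, where `A` generates the semigroup `S` (so that `A*` generates the semigroup `S(·)*`). -/
def IsBackwardMildSolution (S : ℝ → X →L[ℝ] X) (g : ℝ → X) (l₁ : X) (T : ℝ) (l : ℝ → X) : Prop :=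
  ContinuousOn l (Icc 0 T) ∧
    ∀ t ∈ Icc 0 T, l t = (S (T - t)).adjoint l₁ - ∫ s in t..T, (S (s - t)).adjoint (g s)

/-- `u ∈ L²(0,T; U)` and `y` is the trajectory of `y' = A y + B u`, `y(0) = y₀` on `[0,T]`. -/
def IsAdmissible (S : ℝ → X →L[ℝ] X) (B : U →L[ℝ] X) (y₀ : X) (T : ℝ)
    (y : ℝ → X) (u : ℝ → U) : Prop :=
  MemLp u 2 (volume.restrict (Ioc 0 T)) ∧ IsMildSolution S (fun s => B (u s)) y₀ T y

/-- The integrand `½ (‖C (y - y_d)‖² + ‖Q^{1/2} (u - u_d)‖²)` of the cost. The last term is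
written `⟨Q (u - u_d), u - u_d⟩`, which is the same number for a positive operator `Q`. -/
noncomputable def runningCost (C : X →L[ℝ] V) (Q : U ≃L[ℝ] U) (y_d : X) (u_d : U)
    (y : X) (u : U) : ℝ :=
  (1 / 2 : ℝ) * (‖C (y - y_d)‖ ^ 2 + inner ℝ (Q (u - u_d)) (u - u_d))

/-- `(y, u)` is an optimal pair of the linear-quadratic problem on `[0,T]`. -/
def IsOptimalPair (S : ℝ → X →L[ℝ] X) (B : U →L[ℝ] X) (C : X →L[ℝ] V) (Q : U ≃L[ℝ] U)
    (y_d : X) (u_d : U) (y₀ : X) (T : ℝ) (y : ℝ → X) (u : ℝ → U) : Prop :=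
  IsAdmissible S B y₀ T y u ∧
    ∀ (y' : ℝ → X) (u' : ℝ → U), IsAdmissible S B y₀ T y' u' →
      ∫ t in (0 : ℝ)..T, runningCost C Q y_d u_d (y t) (u t) ≤
        ∫ t in (0 : ℝ)..T, runningCost C Q y_d u_d (y' t) (u' t)

/-- `(y, l, u)` is an optimal triple: `(y, u)` is an optimal pair and `l` is its adjoint state,
the mild solution of `l' = C*C y - A* l - C*C y_d`, `l(T) = 0`. The condition
`u = u_d + Q⁻¹ B* l` is not required: it is a consequence of optimality. -/
def IsOptimalTriple (S : ℝ → X →L[ℝ] X) (B : U →L[ℝ] X) (C : X →L[ℝ] V) (Q : U ≃L[ℝ] U)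
    (y_d : X) (u_d : U) (y₀ : X) (T : ℝ) (y l : ℝ → X) (u : ℝ → U) : Prop :=
  IsOptimalPair S B C Q y_d u_d y₀ T y u ∧
    IsBackwardMildSolution S (fun s => C.adjoint (C (y s - y_d))) 0 T l

/-- `(y, u)` is a steady state of the control system: `y ∈ D(A)` and `A y + B u = 0`. -/
def IsSteadyState (A : X →ₗ.[ℝ] X) (B : U →L[ℝ] X) (y : X) (u : U) : Prop :=
  ∃ hy : y ∈ A.domain, A ⟨y, hy⟩ + B u = 0

/-- `(y, u)` is an optimal pair of the static problem. -/
def IsOptimalSteadyPair (A : X →ₗ.[ℝ] X) (B : U →L[ℝ] X) (C : X →L[ℝ] V) (Q : U ≃L[ℝ] U)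
    (y_d : X) (u_d : U) (y : X) (u : U) : Prop :=
  IsSteadyState A B y u ∧
    ∀ (y' : X) (u' : U), IsSteadyState A B y' u' →
      runningCost C Q y_d u_d y u ≤ runningCost C Q y_d u_d y' u'

/-- `(y, l, u)` is an optimal steady-state triple: `(y, u)` is an optimal pair of the static
problem and `l ∈ D(A*)` is an adjoint state for it, i.e. `C*C y - A* l - C*C y_d = 0` and
`u = u_d + Q⁻¹ B* l`. -/
def IsOptimalSteadyTriple (A : X →ₗ.[ℝ] X) (B : U →L[ℝ] X) (C : X →L[ℝ] V) (Q : U ≃L[ℝ] U)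
    (y_d : X) (u_d : U) (y l : X) (u : U) : Prop :=
  IsOptimalSteadyPair A B C Q y_d u_d y u ∧
    (∃ hl : l ∈ A.adjoint.domain,
      C.adjoint (C y) - A.adjoint ⟨l, hl⟩ - C.adjoint (C y_d) = 0) ∧
    u = u_d + Q.symm (B.adjoint l)

end LQTurnpike

set_option linter.unusedSectionVars false

namespace LQTurnpike

variable {X U V : Type*}
  [NormedAddCommGroup X] [InnerProductSpace ℝ X] [CompleteSpace X]
  [NormedAddCommGroup U] [InnerProductSpace ℝ U] [CompleteSpace U]
  [NormedAddCommGroup V] [InnerProductSpace ℝ V] [CompleteSpace V]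

/-! ### `C₀` semigroups -/

namespace IsC0Semigroup

variable {S : ℝ → X →L[ℝ] X}

/-! Put x = y^T - y_s and p = λ^T - λ_s. The targets y_d, u_d cancel, and x' = A x + B v, p' = C*C x
- A* p with v = Q⁻¹ B* p. In the derivative of φ = ⟨x, p⟩ the generator cancels, leaving φ' = ⟨Q v,
v⟩ + ‖C x‖² ≥ 0. So φ is nondecreasing, |φ| ≤ ‖x‖ ‖p‖, and increments of φ control v and C x in L².

Detectability lets the equation of x be read with the stable operator A + K₁* C and the forcing B v
- K₁* C x. Hence x decays forward in time up to a multiple of √(φ b - φ a). Stabilizability gives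
the same for p backward in time (`decayPair_of_extremal`).

What remains concerns scalar functions. The increment of φ over [a, b] is at most ‖x(b)‖ ‖p(b)‖ +
‖x(a)‖ ‖p(a)‖; inserting the two decay estimates bounds its square root by a constant times g =
‖x(a)‖ + ‖p(b)‖, whatever the length b - a. At each end of [a, b] take n consecutive steps of length
ℓ: some step carries at most 1/n of the increment, and crossing it makes x (on the left) or p (on
the right) small. Thus g is halved at a bounded cost in length, and iteration yields exponential
decay (`exists_halving`, `exists_decayPair_bound`). No Riccati equation is involved.

Since solutions are only mild, the product rule is replaced by the duality identity
`IsMildSolution.inner_sub_inner`, which rests on Fubini. The feedback law of the optimal control is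
`IsOptimalTriple.control_eq`. -/

theorem tendsto_orbit_zero (hS : IsC0Semigroup S) (x : X) :
    Tendsto (fun τ => S τ x) (𝓝[≥] 0) (𝓝 x) := by
  rw [← Ioi_insert, nhdsWithin_insert]
  refine Tendsto.sup ?_ (hS.strongly_continuous x)
  rw [tendsto_pure_left]
  intro s hs
  simpa [hS.map_zero] using mem_of_mem_nhds hs

/-- Otherwise ‖S(t_n)‖ > n along some t_n → 0. Each orbit converges along t_n, hence is bounded,
which contradicts the uniform boundedness principle. -/
theorem exists_bound_near_zero (hS : IsC0Semigroup S) :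
    ∃ δ > 0, ∃ M : ℝ, ∀ t ∈ Icc 0 δ, ‖S t‖ ≤ M := by
  by_contra! H
  have h : ∀ n : ℕ, ∃ t ∈ Icc (0 : ℝ) (1 / (n + 1)), (n : ℝ) < ‖S t‖ := fun n =>
    H (1 / (n + 1)) (by positivity) n
  choose t ht hlt using h
  have hpt : ∀ x, ∃ K, ∀ n, ‖S (t n) x‖ ≤ K := by
    intro x
    have htend : Tendsto t atTop (𝓝[≥] 0) :=
      tendsto_nhdsWithin_iff.2 ⟨squeeze_zero (fun n => (ht n).1) (fun n => (ht n).2)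
        tendsto_one_div_add_atTop_nhds_zero_nat, Eventually.of_forall fun n => (ht n).1⟩
    obtain ⟨K, hK⟩ := ((hS.tendsto_orbit_zero x).comp htend).norm.bddAbove_range
    exact ⟨K, fun n => hK ⟨n, rfl⟩⟩
  obtain ⟨K, hK⟩ := banach_steinhaus hpt
  obtain ⟨n, hn⟩ := exists_nat_gt K
  exact absurd (hK n) (not_le.2 (hn.trans (hlt n)))

theorem exists_bound (hS : IsC0Semigroup S) (T : ℝ) :
    ∃ M : ℝ, 0 < M ∧ ∀ t ∈ Icc 0 T, ‖S t‖ ≤ M := by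
  obtain ⟨δ, hδ, M, hM⟩ := hS.exists_bound_near_zero
  have key : ∀ n : ℕ, ∀ t ∈ Icc 0 (n * δ), ‖S t‖ ≤ (max M 1) ^ (n + 1) := by
    intro n
    induction n with
    | zero =>
      intro t ht
      simp only [Nat.cast_zero, zero_mul] at ht
      simpa using Or.inl (hM t ⟨ht.1, ht.2.trans hδ.le⟩)
    | succ n ih =>
      intro t ht
      have h1 : (1 : ℝ) ≤ max M 1 := le_max_right _ _
      rcases le_total t δ with h | h
      · exact ((hM t ⟨ht.1, h⟩).trans (le_max_left _ _)).trans (le_self_pow₀ h1 (by omega))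
      · have e : S t = (S (t - δ)).comp (S δ) := by
          rw [← hS.map_add _ _ (sub_nonneg.2 h) hδ.le, sub_add_cancel]
        have h2 := ht.2
        push_cast at h2
        calc ‖S t‖ ≤ ‖S (t - δ)‖ * ‖S δ‖ := e ▸ ContinuousLinearMap.opNorm_comp_le _ _
          _ ≤ (max M 1) ^ (n + 1) * max M 1 := by
            gcongr
            · exact ih _ ⟨sub_nonneg.2 h, by linarith⟩
            · exact (hM δ ⟨hδ.le, le_rfl⟩).trans (le_max_left _ _)
          _ = (max M 1) ^ (n + 1 + 1) := (pow_succ _ _).symm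
  obtain ⟨n, hn⟩ := exists_nat_ge (T / δ)
  refine ⟨_, by positivity, fun t ht => key n t ⟨ht.1, ht.2.trans ?_⟩⟩
  rwa [div_le_iff₀ hδ] at hn

theorem map_add_apply (hS : IsC0Semigroup S) {s t : ℝ} (hs : 0 ≤ s) (ht : 0 ≤ t) (x : X) :
    S (s + t) x = S s (S t x) := by
  rw [hS.map_add s t hs ht, ContinuousLinearMap.comp_apply]

theorem map_zero_apply (hS : IsC0Semigroup S) (x : X) : S 0 x = x := by
  rw [hS.map_zero, ContinuousLinearMap.id_apply]

/-- The semigroup, extended by the identity to negative times, is jointly continuous. -/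
theorem continuous_max (hS : IsC0Semigroup S) :
    Continuous fun p : ℝ × X => S (max p.1 0) p.2 := by
  have horb : ∀ x, Continuous fun t : ℝ => S (max t 0) x := by
    intro x
    rw [continuous_iff_continuousAt]
    intro t
    obtain ⟨M, hM0, hM⟩ := hS.exists_bound (max t 0 + 1)
    have hd : Tendsto (fun τ : ℝ => |max τ 0 - max t 0|) (𝓝 t) (𝓝[≥] 0) := by
      refine tendsto_nhdsWithin_iff.2 ⟨?_, Eventually.of_forall fun τ => mem_Ici.2 (abs_nonneg _)⟩
      have : Continuous fun τ : ℝ => |max τ 0 - max t 0| := by fun_prop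
      simpa using this.tendsto t
    have hlim : Tendsto (fun τ : ℝ => M * ‖S |max τ 0 - max t 0| x - x‖) (𝓝 t) (𝓝 0) := by
      have := ((((hS.tendsto_orbit_zero x).comp hd).sub_const x).norm).const_mul M
      simpa using this
    rw [ContinuousAt, tendsto_iff_norm_sub_tendsto_zero]
    refine squeeze_zero' (Eventually.of_forall fun _ => norm_nonneg _) ?_ hlim
    have hnear : ∀ᶠ τ in 𝓝 t, max τ 0 < max t 0 + 1 := by
      have : Continuous fun τ : ℝ => max τ 0 := by fun_prop
      exact this.continuousAt.eventually_lt continuousAt_const (by linarith)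
    -- Factoring out the smaller of the two times reduces continuity from the left and from the
    -- right alike to continuity at 0.
    have key : ∀ a b : ℝ, 0 ≤ a → a ≤ b → a ≤ max t 0 + 1 →
        ‖S b x - S a x‖ ≤ M * ‖S (b - a) x - x‖ := by
      intro a b ha hab haM
      have : S b x - S a x = S a (S (b - a) x - x) := by
        rw [map_sub, ← hS.map_add_apply ha (sub_nonneg.2 hab), add_sub_cancel]
      rw [this]
      exact (S a).le_of_opNorm_le (hM a ⟨ha, haM⟩) _
    filter_upwards [hnear] with τ hτ
    rcases le_total (max τ 0) (max t 0) with h | h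
    · rw [abs_of_nonpos (sub_nonpos.2 h), neg_sub, norm_sub_rev]
      exact key _ _ (le_max_right _ _) h (by linarith)
    · rw [abs_of_nonneg (sub_nonneg.2 h)]
      exact key _ _ (le_max_right _ _) h (by linarith)
  rw [continuous_iff_continuousAt]
  rintro ⟨t, x⟩
  obtain ⟨M, hM0, hM⟩ := hS.exists_bound (max t 0 + 1)
  rw [ContinuousAt, tendsto_iff_norm_sub_tendsto_zero]
  have hlim : Tendsto (fun p : ℝ × X => M * ‖p.2 - x‖ + ‖S (max p.1 0) x - S (max t 0) x‖)
      (𝓝 (t, x)) (𝓝 0) := by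
    have hc : Continuous fun p : ℝ × X =>
        M * ‖p.2 - x‖ + ‖S (max p.1 0) x - S (max t 0) x‖ := by
      have h1 : Continuous fun p : ℝ × X => S (max p.1 0) x := (horb x).comp continuous_fst
      exact (continuous_const.mul (continuous_snd.sub continuous_const).norm).add
        (h1.sub continuous_const).norm
    simpa using hc.tendsto (t, x)
  refine squeeze_zero' (Eventually.of_forall fun _ => norm_nonneg _) ?_ hlim
  have hnear : ∀ᶠ p : ℝ × X in 𝓝 (t, x), max p.1 0 < max t 0 + 1 := by
    have : Continuous fun p : ℝ × X => max p.1 0 := by fun_prop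
    exact this.continuousAt.eventually_lt continuousAt_const (by simp)
  filter_upwards [hnear] with p hp
  have : S (max p.1 0) p.2 - S (max t 0) x =
      S (max p.1 0) (p.2 - x) + (S (max p.1 0) x - S (max t 0) x) := by
    rw [map_sub]; abel
  rw [this]
  refine (norm_add_le _ _).trans ?_
  gcongr
  exact (S _).le_of_opNorm_le (hM _ ⟨le_max_right _ _, hp.le⟩) _

theorem continuous_orbit (hS : IsC0Semigroup S) (x : X) :
    Continuous fun t : ℝ => S (max t 0) x :=
  hS.continuous_max.comp (by fun_prop : Continuous fun t : ℝ => (t, x))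

/-! ### Averages along orbits -/

/-- `∫₀ʰ S(s) ds` as a bounded operator. -/
noncomputable def primitive (hS : IsC0Semigroup S) (h : ℝ) : X →L[ℝ] X :=
  LinearMap.mkContinuousOfExistsBound
    { toFun := fun x => ∫ s in (0 : ℝ)..h, S (max s 0) x
      map_add' := fun x y => by
        simp only [_root_.map_add]
        exact intervalIntegral.integral_add ((hS.continuous_orbit x).intervalIntegrable _ _)
          ((hS.continuous_orbit y).intervalIntegrable _ _)
      map_smul' := fun c x => by
        simp only [map_smul, RingHom.id_apply]
        exact intervalIntegral.integral_smul _ _ }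
    (by
      obtain ⟨M, hM0, hM⟩ := hS.exists_bound (max h 0)
      refine ⟨M * |h - 0|, fun x => ?_⟩
      have := intervalIntegral.norm_integral_le_of_norm_le_const (a := 0) (b := h)
        (f := fun s => S (max s 0) x) (C := M * ‖x‖) (fun s hs => by
          refine (S _).le_of_opNorm_le (hM _ ⟨le_max_right _ _, ?_⟩) _
          rcases le_total 0 h with h0 | h0
          · rw [uIoc_of_le h0] at hs
            exact max_le_max_right 0 hs.2
          · rw [uIoc_of_ge h0] at hs
            rw [max_eq_right hs.2]
            exact le_max_right _ _)
      change ‖∫ s in (0 : ℝ)..h, S (max s 0) x‖ ≤ _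
      linarith)

theorem primitive_apply (hS : IsC0Semigroup S) (h : ℝ) (x : X) :
    hS.primitive h x = ∫ s in (0 : ℝ)..h, S (max s 0) x := rfl

theorem primitive_hasDerivAt (hS : IsC0Semigroup S) (h : ℝ) (x : X) :
    HasDerivAt (fun h => hS.primitive h x) (S (max h 0) x) h :=
  intervalIntegral.integral_hasDerivAt_right ((hS.continuous_orbit x).intervalIntegrable _ _)
    (hS.continuous_orbit x).stronglyMeasurable.stronglyMeasurableAtFilter
    (hS.continuous_orbit x).continuousAt

theorem primitive_zero (hS : IsC0Semigroup S) : hS.primitive 0 = 0 := by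
  ext x; simp [primitive_apply]

theorem norm_primitive_le (hS : IsC0Semigroup S) {M h : ℝ} (hM : ∀ t ∈ Icc 0 h, ‖S t‖ ≤ M)
    (hh : 0 ≤ h) (x : X) : ‖hS.primitive h x‖ ≤ M * h * ‖x‖ := by
  have := intervalIntegral.norm_integral_le_of_norm_le_const (a := 0) (b := h)
    (f := fun s => S (max s 0) x) (C := M * ‖x‖) (fun s hs => by
      rw [uIoc_of_le hh] at hs
      rw [max_eq_left hs.1.le]
      exact (S _).le_of_opNorm_le (hM _ ⟨hs.1.le, hs.2⟩) _)
  rw [primitive_apply]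
  rw [sub_zero, abs_of_nonneg hh] at this
  linarith

theorem integral_shift (hS : IsC0Semigroup S) {t h : ℝ} (ht : 0 ≤ t) (hh : 0 ≤ h) (x : X) :
    ∫ s in (0 : ℝ)..h, S (s + t) x = hS.primitive (h + t) x - hS.primitive t x := by
  rw [primitive_apply, primitive_apply, intervalIntegral.integral_interval_sub_left
    ((hS.continuous_orbit x).intervalIntegrable _ _)
    ((hS.continuous_orbit x).intervalIntegrable _ _)]
  have := intervalIntegral.integral_comp_add_right (a := 0) (b := h)
    (fun s => S (max s 0) x) t
  rw [zero_add] at this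
  rw [← this]
  refine intervalIntegral.integral_congr fun s hs => ?_
  rw [uIcc_of_le hh] at hs
  rw [max_eq_left (add_nonneg hs.1 ht)]

theorem apply_primitive (hS : IsC0Semigroup S) {t h : ℝ} (ht : 0 ≤ t) (hh : 0 ≤ h) (x : X) :
    S t (hS.primitive h x) = hS.primitive (h + t) x - hS.primitive t x := by
  rw [← hS.integral_shift ht hh, primitive_apply, ← ContinuousLinearMap.intervalIntegral_comp_comm _
    ((hS.continuous_orbit x).intervalIntegrable _ _)]
  refine intervalIntegral.integral_congr fun s hs => ?_
  rw [uIcc_of_le hh] at hs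
  rw [max_eq_left hs.1, ← hS.map_add_apply ht hs.1, add_comm]

theorem primitive_comp_apply (hS : IsC0Semigroup S) {t h : ℝ} (ht : 0 ≤ t) (hh : 0 ≤ h) (x : X) :
    hS.primitive h (S t x) = hS.primitive (h + t) x - hS.primitive t x := by
  rw [← hS.integral_shift ht hh, primitive_apply]
  refine intervalIntegral.integral_congr fun s hs => ?_
  rw [uIcc_of_le hh] at hs
  rw [max_eq_left hs.1, ← hS.map_add_apply hs.1 ht]

theorem tendsto_average (hS : IsC0Semigroup S) (x : X) :
    Tendsto (fun h : ℝ => h⁻¹ • hS.primitive h x) (𝓝[>] 0) (𝓝 x) := by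
  simpa [hS.primitive_zero, hS.map_zero] using
    (hS.primitive_hasDerivAt 0 x).tendsto_slope_zero_right

/-! ### The adjoint semigroup -/

/-- By local boundedness of ‖S(t)*‖, the space `D` of good vectors is closed. It contains the ranges
of the adjoints of the primitives, and these span a dense space: a vector orthogonal to all of them
is killed by every primitive, hence is a limit of zero averages. -/
theorem adjoint_strongly_continuous (hS : IsC0Semigroup S) (x : X) :
    Tendsto (fun t : ℝ => (S t).adjoint x) (𝓝[>] 0) (𝓝 x) := by
  obtain ⟨M, hM0, hM⟩ := hS.exists_bound 1
  let D : Submodule ℝ X :=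
    { carrier := {x | Tendsto (fun t : ℝ => (S t).adjoint x) (𝓝[>] 0) (𝓝 x)}
      add_mem' := fun {a b} ha hb =>
        (Tendsto.add ha hb).congr fun t => (_root_.map_add _ _ _).symm
      zero_mem' := by simp
      smul_mem' := fun c a ha =>
        (Tendsto.const_smul ha c).congr fun t => (map_smul _ _ _).symm }
  have hunit : ∀ᶠ t : ℝ in 𝓝[>] 0, t ∈ Ioc (0 : ℝ) 1 := Ioc_mem_nhdsGT one_pos
  have hmem : ∀ h, 0 ≤ h → ∀ x, (hS.primitive h).adjoint x ∈ D := by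
    intro h hh x
    obtain ⟨M', hM0', hM'⟩ := hS.exists_bound h
    change Tendsto _ _ _
    rw [tendsto_iff_norm_sub_tendsto_zero]
    have hlim : Tendsto (fun t : ℝ => (M' + 1) * (M * t) * ‖x‖) (𝓝[>] 0) (𝓝 0) := by
      have : Continuous fun t : ℝ => (M' + 1) * (M * t) * ‖x‖ := by fun_prop
      simpa using (this.tendsto 0).mono_left nhdsWithin_le_nhds
    refine squeeze_zero' (Eventually.of_forall fun _ => norm_nonneg _) ?_ hlim
    filter_upwards [hunit] with t ht
    have e : (S t).adjoint ((hS.primitive h).adjoint x) - (hS.primitive h).adjoint x =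
        (((hS.primitive h).comp (S t)) - hS.primitive h).adjoint x := by
      rw [map_sub, ContinuousLinearMap.adjoint_comp]; rfl
    rw [e]
    refine ContinuousLinearMap.le_of_opNorm_le (ContinuousLinearMap.adjoint _ : X →L[ℝ] X) ?_ x
    rw [LinearIsometryEquiv.norm_map]
    refine ContinuousLinearMap.opNorm_le_bound _ (by have := ht.1; positivity) fun z => ?_
    -- Both sides equal P(h + t) - P(h) - P(t), where P is the primitive. Exchanging the roles of
    -- `h` and `t` exhibits the factor P(t), of norm at most `M * t`.
    have e2 : ((hS.primitive h).comp (S t) - hS.primitive h) z =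
        S h (hS.primitive t z) - hS.primitive t z := by
      rw [hS.apply_primitive hh ht.1.le]
      simp only [sub_apply, ContinuousLinearMap.comp_apply]
      rw [hS.primitive_comp_apply ht.1.le hh, add_comm t h]
      abel
    rw [e2]
    have h1 : ‖hS.primitive t z‖ ≤ M * t * ‖z‖ :=
      hS.norm_primitive_le (fun s hs => hM s ⟨hs.1, hs.2.trans ht.2⟩) ht.1.le z
    calc ‖S h (hS.primitive t z) - hS.primitive t z‖
        ≤ M' * ‖hS.primitive t z‖ + ‖hS.primitive t z‖ := (norm_sub_le _ _).trans (by
          gcongr; exact (S h).le_of_opNorm_le (hM' h ⟨hh, le_rfl⟩) _)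
      _ = (M' + 1) * ‖hS.primitive t z‖ := by ring
      _ ≤ (M' + 1) * (M * t * ‖z‖) := by gcongr
      _ = (M' + 1) * (M * t) * ‖z‖ := by ring
  have hdense : D.topologicalClosure = ⊤ := by
    rw [Submodule.topologicalClosure_eq_top_iff, Submodule.eq_bot_iff]
    intro z hz
    rw [Submodule.mem_orthogonal] at hz
    have h0 : ∀ h, 0 ≤ h → hS.primitive h z = 0 := fun h hh => by
      refine ext_inner_left ℝ fun x => ?_
      rw [← ContinuousLinearMap.adjoint_inner_left, inner_zero_right]
      exact hz _ (hmem h hh x)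
    refine tendsto_nhds_unique (hS.tendsto_average z) (tendsto_const_nhds.congr' ?_)
    filter_upwards [hunit] with h hh
    rw [h0 h hh.1.le, smul_zero]
  have hx : x ∈ closure (D : Set X) := by
    rw [← Submodule.topologicalClosure_coe, hdense]; trivial
  rw [Metric.tendsto_nhds]
  intro ε hε
  obtain ⟨d, hd, hdx⟩ := Metric.mem_closure_iff.1 hx (ε / (2 * (M + 1))) (by positivity)
  have hd' : Tendsto (fun t : ℝ => (S t).adjoint d) (𝓝[>] 0) (𝓝 d) := hd
  filter_upwards [hunit, (Metric.tendsto_nhds.1 hd') (ε / 2) (by positivity)] with t ht htd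
  rw [dist_eq_norm] at *
  have e : (S t).adjoint x - x = (S t).adjoint (x - d) + ((S t).adjoint d - d) - (x - d) := by
    rw [map_sub]; abel
  have h1 : ‖(S t).adjoint (x - d)‖ ≤ M * ‖x - d‖ :=
    ContinuousLinearMap.le_of_opNorm_le (ContinuousLinearMap.adjoint (S t) : X →L[ℝ] X) (by
      rw [LinearIsometryEquiv.norm_map]; exact hM t ⟨ht.1.le, ht.2⟩) _
  rw [lt_div_iff₀ (by positivity)] at hdx
  calc ‖(S t).adjoint x - x‖ ≤ ‖(S t).adjoint (x - d)‖ + ‖(S t).adjoint d - d‖ + ‖x - d‖ := by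
        rw [e]; exact (norm_sub_le _ _).trans (by gcongr; exact norm_add_le _ _)
    _ < ε := by linarith

theorem adjoint (hS : IsC0Semigroup S) : IsC0Semigroup fun t => (S t).adjoint where
  map_zero := by
    refine ContinuousLinearMap.ext fun x => ext_inner_right ℝ fun y => ?_
    rw [ContinuousLinearMap.adjoint_inner_left, hS.map_zero_apply, ContinuousLinearMap.id_apply]
  map_add s t hs ht := by
    rw [add_comm, hS.map_add t s ht hs, ContinuousLinearMap.adjoint_comp]
  strongly_continuous := hS.adjoint_strongly_continuous

end IsC0Semigroup

/-! ### Generators -/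

namespace Generates

variable {A : X →ₗ.[ℝ] X} {S : ℝ → X →L[ℝ] X}

theorem tendsto_apply (h : Generates A S) (x : A.domain) :
    Tendsto (fun h : ℝ => h⁻¹ • (S h x - x)) (𝓝[>] 0) (𝓝 (A x)) :=
  (h.mem_graph_iff x (A x)).1 (A.mem_graph x)

theorem mem_domain (h : Generates A S) {x z : X}
    (hx : Tendsto (fun h : ℝ => h⁻¹ • (S h x - x)) (𝓝[>] 0) (𝓝 z)) :
    ∃ hx : x ∈ A.domain, A ⟨x, hx⟩ = z := by
  obtain ⟨y, hy, hz⟩ := (LinearPMap.mem_graph_iff A).1 ((h.mem_graph_iff x z).2 hx)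
  subst hy
  exact ⟨y.2, hz⟩

/-- The difference quotient of the semigroup at the primitive is the slope of the primitive at `t`
minus its slope at 0. -/
theorem apply_primitive (h : Generates A S) {t : ℝ} (ht : 0 ≤ t) (x : X) :
    ∃ hx : h.isC0Semigroup.primitive t x ∈ A.domain, A ⟨_, hx⟩ = S t x - x := by
  have hS := h.isC0Semigroup
  have h1 := (hS.primitive_hasDerivAt t x).tendsto_slope_zero_right
  have h2 := (hS.primitive_hasDerivAt 0 x).tendsto_slope_zero_right
  rw [max_eq_left ht] at h1
  rw [max_self, hS.map_zero_apply] at h2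
  refine h.mem_domain ((h1.sub h2).congr' ?_)
  filter_upwards [self_mem_nhdsWithin] with s hs
  rw [hS.apply_primitive (le_of_lt hs) ht, hS.primitive_zero, ← smul_sub]
  simp only [zero_add, zero_apply, sub_zero]
  congr 1; abel

theorem dense_domain (h : Generates A S) : Dense (A.domain : Set X) := by
  intro x
  refine mem_closure_of_tendsto (h.isC0Semigroup.tendsto_average x) ?_
  filter_upwards [self_mem_nhdsWithin] with t ht
  exact A.domain.smul_mem _ (h.apply_primitive (le_of_lt ht) x).1

/-- The domain of the generator is invariant and the generator commutes with the semigroup. -/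
theorem tendsto_apply_orbit (h : Generates A S) (x : A.domain) {t : ℝ} (ht : 0 ≤ t) :
    Tendsto (fun h : ℝ => h⁻¹ • (S h (S t x) - S t x)) (𝓝[>] 0) (𝓝 (S t (A x))) := by
  have hS := h.isC0Semigroup
  refine (((S t).continuous.tendsto _).comp (h.tendsto_apply x)).congr' ?_
  filter_upwards [self_mem_nhdsWithin] with s hs
  have hs0 : (0 : ℝ) ≤ s := le_of_lt hs
  rw [Function.comp_apply, map_smul, map_sub, ← hS.map_add_apply ht hs0,
    ← hS.map_add_apply hs0 ht, add_comm]

end Generates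

/-! ### Adjoints of the primitive and of the generator -/

theorem inner_intervalIntegral_right {f : ℝ → X} {a b : ℝ} (c : X)
    (hf : IntervalIntegrable f volume a b) :
    inner ℝ c (∫ s in a..b, f s) = ∫ s in a..b, inner ℝ c (f s) :=
  ((innerSL ℝ c).intervalIntegral_comp_comm hf).symm

theorem inner_intervalIntegral_left {f : ℝ → X} {a b : ℝ} (c : X)
    (hf : IntervalIntegrable f volume a b) :
    inner ℝ (∫ s in a..b, f s) c = ∫ s in a..b, inner ℝ (f s) c := by
  rw [real_inner_comm, inner_intervalIntegral_right c hf]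
  simp only [real_inner_comm]

namespace IsC0Semigroup

variable {S : ℝ → X →L[ℝ] X}

theorem adjoint_primitive_apply (hS : IsC0Semigroup S) (h : ℝ) (x : X) :
    (hS.primitive h).adjoint x = hS.adjoint.primitive h x := by
  refine ext_inner_right ℝ fun z => ?_
  rw [ContinuousLinearMap.adjoint_inner_left, primitive_apply, primitive_apply,
    inner_intervalIntegral_right _ ((hS.continuous_orbit z).intervalIntegrable _ _),
    inner_intervalIntegral_left _ ((hS.adjoint.continuous_orbit x).intervalIntegrable _ _)]
  simp only [ContinuousLinearMap.adjoint_inner_left]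

end IsC0Semigroup

namespace Generates

variable {A : X →ₗ.[ℝ] X} {S : ℝ → X →L[ℝ] X}

/-- The generator of the adjoint semigroup extends the adjoint of the generator. -/
theorem tendsto_adjoint_apply (h : Generates A S) (x : A.adjoint.domain) :
    Tendsto (fun h : ℝ => h⁻¹ • ((S h).adjoint x - x)) (𝓝[>] 0) (𝓝 (A.adjoint x)) := by
  -- The difference quotient of S* at `x` is exactly the average of the S*-orbit of A* x: tested
  -- against z, this is ⟨A* x, P(s) z⟩ = ⟨x, A P(s) z⟩ = ⟨x, S(s) z - z⟩ for the primitive P.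
  refine (h.isC0Semigroup.adjoint.tendsto_average _).congr' ?_
  filter_upwards [self_mem_nhdsWithin] with s hs
  have hs0 : (0 : ℝ) ≤ s := le_of_lt hs
  congr 1
  rw [← h.isC0Semigroup.adjoint_primitive_apply]
  refine ext_inner_right ℝ fun z => ?_
  obtain ⟨hz, hAz⟩ := h.apply_primitive hs0 z
  rw [inner_sub_left, ContinuousLinearMap.adjoint_inner_left,
    ContinuousLinearMap.adjoint_inner_left, ← inner_sub_right, ← hAz]
  exact ((LinearPMap.adjoint_isFormalAdjoint h.dense_domain) x ⟨_, hz⟩)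

end Generates

/-! ### Convolutions with a semigroup -/

section Convolution

variable {S : ℝ → X →L[ℝ] X}

theorem IsC0Semigroup.intervalIntegrable_conv (hS : IsC0Semigroup S) {f : ℝ → X} {a t : ℝ}
    (hat : a ≤ t) (hf : IntervalIntegrable f volume a t) :
    IntervalIntegrable (fun s => S (t - s) (f s)) volume a t := by
  rw [intervalIntegrable_iff_integrableOn_Ioc_of_le hat] at hf ⊢
  obtain ⟨M, hM0, hM⟩ := hS.exists_bound (t - a)
  refine Integrable.mono' (hf.norm.const_mul M) ?_ ?_
  · have h1 : AEStronglyMeasurable (fun s => S (max (t - s) 0) (f s)) (volume.restrict (Ioc a t)) :=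
      hS.continuous_max.comp_aestronglyMeasurable
        ((by fun_prop : Continuous fun s : ℝ => t - s).aestronglyMeasurable.prodMk
          hf.aestronglyMeasurable)
    refine h1.congr ?_
    filter_upwards [ae_restrict_mem measurableSet_Ioc] with s hs
    rw [max_eq_left (sub_nonneg.2 hs.2)]
  · filter_upwards [ae_restrict_mem measurableSet_Ioc] with s hs
    exact (S _).le_of_opNorm_le (hM _ ⟨sub_nonneg.2 hs.2, by linarith [hs.1]⟩) _

theorem IsC0Semigroup.continuousOn_conv (hS : IsC0Semigroup S) {f : ℝ → X} {T : ℝ} (hT : 0 ≤ T)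
    (hf : IntervalIntegrable f volume 0 T) :
    ContinuousOn (fun t => ∫ s in (0 : ℝ)..t, S (t - s) (f s)) (Icc 0 T) := by
  rw [intervalIntegrable_iff_integrableOn_Ioc_of_le hT] at hf
  obtain ⟨M, hM0, hM⟩ := hS.exists_bound T
  -- An indicator moves the dependence on `t` from the domain into the integrand, so that dominated
  -- convergence applies; the jump is at `s = t` only, a null set for each limit point.
  have key : ∀ t ∈ Icc 0 T, ∫ s in (0 : ℝ)..t, S (t - s) (f s) =
      ∫ s in Ioc 0 T, (Iio t).indicator (fun s => S (max (t - s) 0) (f s)) s := by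
    intro t ht
    rw [intervalIntegral.integral_of_le ht.1, integral_indicator measurableSet_Iio,
      Measure.restrict_restrict measurableSet_Iio]
    have e : Iio t ∩ Ioc 0 T = Ioo 0 t := by
      ext s
      simp only [mem_inter_iff, mem_Iio, mem_Ioc, mem_Ioo]
      exact ⟨fun h => ⟨h.2.1, h.1⟩, fun h => ⟨h.2, h.1, h.2.le.trans ht.2⟩⟩
    rw [e, integral_Ioc_eq_integral_Ioo]
    refine setIntegral_congr_fun measurableSet_Ioo fun s hs => ?_
    rw [max_eq_left (sub_nonneg.2 hs.2.le)]
  refine ContinuousOn.congr (fun t₀ ht₀ => ?_) key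
  refine continuousWithinAt_of_dominated (bound := fun s => M * ‖f s‖) ?_ ?_ (hf.norm.const_mul M) ?_
  · refine Eventually.of_forall fun t => ?_
    refine AEStronglyMeasurable.indicator ?_ measurableSet_Iio
    exact hS.continuous_max.comp_aestronglyMeasurable
        ((by fun_prop : Continuous fun s : ℝ => t - s).aestronglyMeasurable.prodMk
          hf.aestronglyMeasurable)
  · filter_upwards [self_mem_nhdsWithin] with t ht
    filter_upwards [ae_restrict_mem measurableSet_Ioc] with s hs
    refine (norm_indicator_le_norm_self _ _).trans ?_
    exact (S _).le_of_opNorm_le (hM _ ⟨le_max_right _ _,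
      max_le (by linarith [ht.2, hs.1]) hT⟩) _
  · have hne : ∀ᵐ s : ℝ ∂(volume.restrict (Ioc 0 T)), s ≠ t₀ :=
      ae_restrict_of_ae (by simp [ae_iff])
    filter_upwards [hne] with s hs
    refine ContinuousAt.continuousWithinAt ?_
    rcases lt_or_gt_of_ne hs with h | h
    · have h1 : Continuous fun t : ℝ => S (max (t - s) 0) (f s) :=
        hS.continuous_max.comp (by fun_prop : Continuous fun t : ℝ => (t - s, f s))
      refine h1.continuousAt.congr ?_
      filter_upwards [Ioi_mem_nhds h] with t ht
      rw [indicator_of_mem (mem_Iio.2 ht)]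
    · refine (continuousAt_const (y := (0 : X))).congr ?_
      filter_upwards [Iio_mem_nhds h] with t ht
      rw [indicator_of_notMem]
      exact notMem_Iio.2 (le_of_lt (mem_Iio.1 ht))

theorem IsC0Semigroup.isMildSolution_conv (hS : IsC0Semigroup S) {f : ℝ → X} {T : ℝ} (hT : 0 ≤ T)
    (hf : IntervalIntegrable f volume 0 T) (y₀ : X) :
    IsMildSolution S f y₀ T (fun t => S t y₀ + ∫ s in (0 : ℝ)..t, S (t - s) (f s)) := by
  refine ⟨ContinuousOn.add ?_ (hS.continuousOn_conv hT hf), fun t _ => rfl⟩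
  refine (hS.continuous_orbit y₀).continuousOn.congr fun t ht => ?_
  beta_reduce
  rw [max_eq_left ht.1]

namespace IsMildSolution

variable {f g y z : ℝ → X} {y₀ z₀ : X} {T : ℝ}

theorem apply_zero (hS : IsC0Semigroup S) (hT : 0 ≤ T) (hy : IsMildSolution S f y₀ T y) :
    y 0 = y₀ := by
  rw [hy.2 0 ⟨le_rfl, hT⟩]
  simp [hS.map_zero]

theorem congr_ae (hy : IsMildSolution S f y₀ T y)
    (hfg : ∀ᵐ s ∂(volume.restrict (Ioc 0 T)), f s = g s) : IsMildSolution S g y₀ T y := by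
  refine ⟨hy.1, fun t ht => ?_⟩
  rw [hy.2 t ht]
  congr 1
  refine intervalIntegral.integral_congr_ae_restrict ?_
  rw [uIoc_of_le ht.1]
  filter_upwards [ae_restrict_of_ae_restrict_of_subset (Ioc_subset_Ioc_right ht.2) hfg] with s hs
  rw [hs]

theorem add_smul (hS : IsC0Semigroup S) (hf : IntervalIntegrable f volume 0 T)
    (hg : IntervalIntegrable g volume 0 T) (hy : IsMildSolution S f y₀ T y)
    (hz : IsMildSolution S g z₀ T z) (c : ℝ) :
    IsMildSolution S (fun s => f s + c • g s) (y₀ + c • z₀) T (fun s => y s + c • z s) := by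
  refine ⟨hy.1.add (hz.1.const_smul c), fun t ht => ?_⟩
  have hsub : uIcc 0 t ⊆ uIcc 0 T := by
    rw [uIcc_of_le ht.1, uIcc_of_le (ht.1.trans ht.2)]; exact Icc_subset_Icc_right ht.2
  have hgc : IntervalIntegrable (fun s => c • S (t - s) (g s)) volume 0 t :=
    (hS.intervalIntegrable_conv ht.1 (hg.mono_set hsub)).smul c
  simp only [map_add, map_smul]
  rw [hy.2 t ht, hz.2 t ht, intervalIntegral.integral_add
    (hS.intervalIntegrable_conv ht.1 (hf.mono_set hsub)) hgc,
    intervalIntegral.integral_smul, smul_add]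
  abel

theorem sub (hS : IsC0Semigroup S) (hf : IntervalIntegrable f volume 0 T)
    (hg : IntervalIntegrable g volume 0 T) (hy : IsMildSolution S f y₀ T y)
    (hz : IsMildSolution S g z₀ T z) :
    IsMildSolution S (fun s => f s - g s) (y₀ - z₀) T (fun s => y s - z s) := by
  simpa only [neg_smul, one_smul, ← sub_eq_add_neg] using hy.add_smul hS hf hg hz (-1)

theorem restrict (hS : IsC0Semigroup S) (hf : IntervalIntegrable f volume 0 T)
    (hy : IsMildSolution S f y₀ T y) {a b : ℝ} (ha : 0 ≤ a) (hb : b ≤ T) :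
    IsMildSolution S (fun s => f (a + s)) (y a) (b - a) (fun s => y (a + s)) := by
  refine ⟨hy.1.comp (by fun_prop) fun s hs => ⟨add_nonneg ha hs.1, by linarith [hs.2]⟩,
    fun t ht => ?_⟩
  have hT : 0 ≤ T := by linarith [ht.1, ht.2]
  have hat : a + t ∈ Icc 0 T := ⟨add_nonneg ha ht.1, by linarith [ht.2]⟩
  have hf1 : IntervalIntegrable f volume 0 (a + t) := hf.mono_set (by
    rw [uIcc_of_le hat.1, uIcc_of_le hT]; exact Icc_subset_Icc_right hat.2)
  have hf2 : IntervalIntegrable f volume 0 a := hf.mono_set (by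
    rw [uIcc_of_le ha, uIcc_of_le hT]; exact Icc_subset_Icc_right (by linarith [ht.1, ht.2]))
  have h1 := hS.intervalIntegrable_conv hat.1 hf1
  have hsub1 : uIcc 0 a ⊆ uIcc 0 (a + t) := by
    rw [uIcc_of_le ha, uIcc_of_le hat.1]; exact Icc_subset_Icc_right (by linarith [ht.1])
  have hsub2 : uIcc a (a + t) ⊆ uIcc 0 (a + t) := by
    rw [uIcc_of_le (by linarith [ht.1]), uIcc_of_le hat.1]; exact Icc_subset_Icc_left ha
  have e1 : ∫ s in (0 : ℝ)..a, S (a + t - s) (f s) = S t (∫ s in (0 : ℝ)..a, S (a - s) (f s)) := by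
    rw [← ContinuousLinearMap.intervalIntegral_comp_comm _ (hS.intervalIntegrable_conv ha hf2)]
    refine intervalIntegral.integral_congr fun s hs => ?_
    rw [uIcc_of_le ha] at hs
    rw [← hS.map_add_apply ht.1 (sub_nonneg.2 hs.2)]
    congr 2; ring
  have e2 : ∫ s in a..(a + t), S (a + t - s) (f s) =
      ∫ s in (0 : ℝ)..t, S (t - s) (f (a + s)) := by
    have := intervalIntegral.integral_comp_add_left (a := 0) (b := t)
      (fun s => S (a + t - s) (f s)) a
    rw [add_zero] at this
    rw [← this]
    refine intervalIntegral.integral_congr fun s _ => ?_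
    congr 2; ring
  beta_reduce
  rw [hy.2 _ hat, hy.2 a ⟨ha, by linarith [ht.1, ht.2]⟩,
    ← intervalIntegral.integral_add_adjacent_intervals (h1.mono_set hsub1) (h1.mono_set hsub2),
    e1, e2, map_add, add_comm a t, hS.map_add_apply ht.1 ha, add_assoc]

/-- A strict solution in the sense of right derivatives is a mild solution. -/
theorem of_hasDeriv_right (hS : IsC0Semigroup S) {q a : ℝ → X}
    (hq : ContinuousOn q (Icc 0 T)) (hf : ContinuousOn f (Icc 0 T))
    (hgen : ∀ s ∈ Ioo 0 T, Tendsto (fun h : ℝ => h⁻¹ • (S h (q s) - q s)) (𝓝[>] 0) (𝓝 (a s)))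
    (hderiv : ∀ s ∈ Ioo 0 T,
      Tendsto (fun h : ℝ => h⁻¹ • (q (s + h) - q s)) (𝓝[>] 0) (𝓝 (a s + f s))) :
    IsMildSolution S f (q 0) T q := by
  refine ⟨hq, fun t ht => ?_⟩
  have hc : ∀ p : ℝ → X, ContinuousOn p (Icc 0 T) →
      ContinuousOn (fun s => S (max (t - s) 0) (p s)) (Icc 0 t) := fun p hp =>
    hS.continuous_max.comp_continuousOn ((by fun_prop : ContinuousOn (fun s : ℝ => t - s) _).prodMk
      (hp.mono (Icc_subset_Icc_right ht.2)))
  -- For r > s, S(t-r) q(r) - S(t-s) q(s) = S(t-r) [(q(r) - q(s)) - (S(r-s) q(s) - q(s))]. Divided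
  -- by r - s, the bracket tends to (a + f) - a, and joint continuity of the semigroup passes to the
  -- limit.
  have hd : ∀ s ∈ Ioo 0 t, HasDerivWithinAt (fun s => S (max (t - s) 0) (q s))
      (S (max (t - s) 0) (f s)) (Ioi s) s := by
    intro s hs
    have hsT : s ∈ Ioo 0 T := ⟨hs.1, hs.2.trans_le ht.2⟩
    rw [hasDerivWithinAt_iff_tendsto_slope' self_notMem_Ioi]
    have hshift : Tendsto (fun r : ℝ => r - s) (𝓝[>] s) (𝓝[>] 0) := by
      refine tendsto_nhdsWithin_iff.2 ⟨?_, ?_⟩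
      · have : Continuous fun r : ℝ => r - s := by fun_prop
        simpa using (this.tendsto s).mono_left nhdsWithin_le_nhds
      · filter_upwards [self_mem_nhdsWithin] with r hr
        exact mem_Ioi.2 (sub_pos.2 (mem_Ioi.1 hr))
    have hlim := (((hderiv s hsT).sub (hgen s hsT)).comp hshift)
    rw [add_sub_cancel_left] at hlim
    have hr : Tendsto (fun r : ℝ => t - r) (𝓝[>] s) (𝓝 (t - s)) :=
      ((by fun_prop : Continuous fun r : ℝ => t - r).tendsto s).mono_left nhdsWithin_le_nhds
    refine ((hS.continuous_max.tendsto (t - s, f s)).comp (hr.prodMk_nhds hlim)).congr' ?_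
    filter_upwards [Ioo_mem_nhdsGT hs.2] with r hr
    have h1 : 0 ≤ t - r := sub_nonneg.2 hr.2.le
    have h2 : 0 ≤ r - s := sub_nonneg.2 hr.1.le
    have h3 : 0 ≤ t - s := sub_nonneg.2 hs.2.le
    simp only [Function.comp_apply]
    rw [slope_def_module, max_eq_left h1, max_eq_left h3, ← smul_sub, map_smul,
      sub_sub_sub_cancel_right, map_sub, ← hS.map_add_apply h1 h2, add_sub_cancel,
      sub_add_sub_cancel]
  have := intervalIntegral.integral_eq_sub_of_hasDeriv_right_of_le ht.1 (hc q hq) hd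
    (ContinuousOn.intervalIntegrable_of_Icc ht.1 (hc f hf))
  have e : ∫ s in (0 : ℝ)..t, S (t - s) (f s) = ∫ s in (0 : ℝ)..t, S (max (t - s) 0) (f s) := by
    refine intervalIntegral.integral_congr fun s hs => ?_
    rw [uIcc_of_le ht.1] at hs
    rw [max_eq_left (sub_nonneg.2 hs.2)]
  rw [e, this]
  simp [ht.1, hS.map_zero]

end IsMildSolution

/-- Time reversal brings the adjoint state under all results on forward mild solutions, with S* in
place of S. -/
theorem IsBackwardMildSolution.isMildSolution {g l : ℝ → X} {l₁ : X} {T : ℝ}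
    (hl : IsBackwardMildSolution S g l₁ T l) :
    IsMildSolution (fun t => (S t).adjoint) (fun s => -g (T - s)) l₁ T (fun t => l (T - t)) := by
  refine ⟨hl.1.comp (by fun_prop) fun s hs => ⟨by linarith [hs.2], by linarith [hs.1]⟩,
    fun t ht => ?_⟩
  change l (T - t) = _
  rw [hl.2 (T - t) ⟨by linarith [ht.2], by linarith [ht.1]⟩, sub_sub_cancel]
  have := intervalIntegral.integral_comp_sub_left (a := 0) (b := t)
    (fun s => (S (s - (T - t))).adjoint (g s)) T
  rw [sub_zero] at this
  rw [← this, sub_eq_add_neg, ← intervalIntegral.integral_neg]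
  congr 1
  refine intervalIntegral.integral_congr fun s _ => ?_
  beta_reduce
  rw [map_neg]
  congr 4; ring

end Convolution

/-! ### Duality between forward and backward mild solutions -/

theorem intervalIntegrable_inner {f g : ℝ → X} {T : ℝ} (hT : 0 ≤ T)
    (hf : IntervalIntegrable f volume 0 T) (hg : ContinuousOn g (Icc 0 T)) :
    IntervalIntegrable (fun s => inner ℝ (f s) (g s)) volume 0 T := by
  obtain ⟨K, hK⟩ := isCompact_Icc.exists_bound_of_continuousOn hg
  rw [intervalIntegrable_iff_integrableOn_Ioc_of_le hT] at hf ⊢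
  refine Integrable.mono' (hf.norm.mul_const K) (hf.aestronglyMeasurable.inner
    ((hg.mono Ioc_subset_Icc_self).aestronglyMeasurable measurableSet_Ioc)) ?_
  filter_upwards [ae_restrict_mem measurableSet_Ioc] with s hs
  exact (norm_inner_le_norm _ _).trans (by gcongr; exact hK s (Ioc_subset_Icc_self hs))

theorem setIntegral_Ioc_ite_le {g : ℝ → ℝ} {c T : ℝ} (hc : 0 ≤ c) (hcT : c ≤ T) :
    ∫ r in Ioc 0 T, (if r ≤ c then g r else 0) = ∫ r in (0 : ℝ)..c, g r := by
  have e : (fun r => if r ≤ c then g r else 0) = (Iic c).indicator g := by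
    ext r; simp [indicator_apply]
  rw [e, integral_indicator measurableSet_Iic, Measure.restrict_restrict measurableSet_Iic,
    intervalIntegral.integral_of_le hc]
  congr 2
  ext r
  simp only [mem_inter_iff, mem_Iic, mem_Ioc]
  exact ⟨fun h => ⟨h.2.1, h.1⟩, fun h => ⟨h.2, h.1, h.2.trans hcT⟩⟩

/-- This justifies Fubini on the triangle s + r ≤ T. Truncating the time at 0 does not change the
kernel there and makes the semigroup factor jointly measurable. -/
theorem IsC0Semigroup.integrable_convolution_kernel {S : ℝ → X →L[ℝ] X} (hS : IsC0Semigroup S)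
    {T : ℝ} (hT : 0 ≤ T) {f k : ℝ → X} (hf : IntervalIntegrable f volume 0 T)
    (hk : IntervalIntegrable k volume 0 T) :
    Integrable (Function.uncurry fun s r : ℝ =>
      if r ≤ T - s then inner ℝ (S (max (T - s - r) 0) (f s)) (k r) else 0)
      ((volume.restrict (Ioc 0 T)).prod (volume.restrict (Ioc 0 T))) := by
  rw [intervalIntegrable_iff_integrableOn_Ioc_of_le hT] at hf hk
  obtain ⟨M, hM0, hM⟩ := hS.exists_bound T
  have e : (Function.uncurry fun s r : ℝ =>
      if r ≤ T - s then inner ℝ (S (max (T - s - r) 0) (f s)) (k r) else 0) =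
      {p : ℝ × ℝ | p.2 ≤ T - p.1}.indicator
        fun p => inner ℝ (S (max (T - p.1 - p.2) 0) (f p.1)) (k p.2) := by
    ext ⟨s, r⟩; simp [indicator_apply]
  have hD : MeasurableSet {p : ℝ × ℝ | p.2 ≤ T - p.1} :=
    measurableSet_le (by fun_prop) (by fun_prop)
  rw [e]
  refine Integrable.mono' ((hf.norm.mul_prod hk.norm).const_mul M) ?_ ?_
  · refine AEStronglyMeasurable.indicator
      (AEStronglyMeasurable.inner ?_ hk.aestronglyMeasurable.comp_snd) hD
    exact hS.continuous_max.comp_aestronglyMeasurable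
        ((by fun_prop : Continuous fun p : ℝ × ℝ => T - p.1 - p.2).aestronglyMeasurable.prodMk
          hf.aestronglyMeasurable.comp_fst)
  · rw [Measure.prod_restrict]
    filter_upwards [ae_restrict_mem (measurableSet_Ioc.prod measurableSet_Ioc)] with p hp
    refine (norm_indicator_le_norm_self _ _).trans ((norm_inner_le_norm _ _).trans ?_)
    rw [← mul_assoc]
    gcongr
    exact (S _).le_of_opNorm_le (hM _ ⟨le_max_right _ _,
      max_le (by linarith [hp.1.1, hp.2.1]) hT⟩) _

/-- This is the integral of the derivative of ⟨y(s), m(T - s)⟩, in which the generator has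
cancelled. As neither factor need be differentiable, the kernel ⟨S(T-s-r) f(s), k(r)⟩ is integrated
over the triangle in both orders: integrating in r first produces `m`, in s first produces `y`. -/
theorem IsMildSolution.inner_sub_inner {S : ℝ → X →L[ℝ] X} (hS : IsC0Semigroup S)
    {T : ℝ} (hT : 0 ≤ T) {f k y m : ℝ → X} {y₀ m₀ : X} (hf : IntervalIntegrable f volume 0 T)
    (hk : IntervalIntegrable k volume 0 T) (hy : IsMildSolution S f y₀ T y)
    (hm : IsMildSolution (fun t => (S t).adjoint) k m₀ T m) :
    inner ℝ (y T) m₀ - inner ℝ y₀ (m T) =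
      (∫ s in (0 : ℝ)..T, inner ℝ (f s) (m (T - s))) -
        ∫ s in (0 : ℝ)..T, inner ℝ (y (T - s)) (k s) := by
  have hTT : T ∈ Icc 0 T := ⟨hT, le_rfl⟩
  have hrev : ContinuousOn (fun s => T - s) (Icc 0 T) := by fun_prop
  have hmaps : MapsTo (fun s => T - s) (Icc 0 T) (Icc 0 T) := fun s hs =>
    ⟨by linarith [hs.2], by linarith [hs.1]⟩
  have hsub : ∀ s ∈ Ioc 0 T, uIcc 0 (T - s) ⊆ uIcc 0 T := fun s hs => by
    rw [uIcc_of_le (sub_nonneg.2 hs.2), uIcc_of_le hT]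
    exact Icc_subset_Icc_right (by linarith [hs.1])
  have hfm : IntervalIntegrable (fun s => inner ℝ (f s) (m (T - s))) volume 0 T :=
    intervalIntegrable_inner hT hf (hm.1.comp hrev hmaps)
  have hky := intervalIntegrable_inner hT hk (hy.1.comp hrev hmaps)
  have hSf := hS.intervalIntegrable_conv hT hf
  have hSk := hS.adjoint.intervalIntegrable_conv hT hk
  have hSfm : IntervalIntegrable (fun s => inner ℝ (S (T - s) (f s)) m₀) volume 0 T :=
    intervalIntegrable_inner hT hSf continuousOn_const
  have hSky : IntervalIntegrable (fun s => inner ℝ (S (T - s) y₀) (k s)) volume 0 T := by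
    refine (intervalIntegrable_inner hT hSk (continuousOn_const (c := y₀))).congr ?_
    exact fun s _ => by
      rw [ContinuousLinearMap.adjoint_inner_left, real_inner_comm]
  have hswap := integral_integral_swap (hS.integrable_convolution_kernel hT hf hk)
  have h1 : ∫ s in Ioc 0 T, (∫ r in Ioc 0 T,
      (if r ≤ T - s then inner ℝ (S (max (T - s - r) 0) (f s)) (k r) else 0)) =
      ∫ s in (0 : ℝ)..T, (inner ℝ (f s) (m (T - s)) - inner ℝ (S (T - s) (f s)) m₀) := by
    rw [intervalIntegral.integral_of_le hT]
    refine setIntegral_congr_fun measurableSet_Ioc fun s hs => ?_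
    have hs0 : 0 ≤ T - s := sub_nonneg.2 hs.2
    rw [setIntegral_Ioc_ite_le hs0 (by linarith [hs.1]), hm.2 (T - s) ⟨hs0, by linarith [hs.1]⟩,
      inner_add_right, ContinuousLinearMap.adjoint_inner_right, add_sub_cancel_left,
      inner_intervalIntegral_right _
        (hS.adjoint.intervalIntegrable_conv hs0 (hk.mono_set (hsub s hs)))]
    refine intervalIntegral.integral_congr fun r hr => ?_
    rw [uIcc_of_le hs0] at hr
    rw [max_eq_left (sub_nonneg.2 hr.2), ContinuousLinearMap.adjoint_inner_right]
  have h2 : ∫ r in Ioc 0 T, (∫ s in Ioc 0 T,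
      (if r ≤ T - s then inner ℝ (S (max (T - s - r) 0) (f s)) (k r) else 0)) =
      ∫ r in (0 : ℝ)..T, (inner ℝ (y (T - r)) (k r) - inner ℝ (S (T - r) y₀) (k r)) := by
    rw [intervalIntegral.integral_of_le hT]
    refine setIntegral_congr_fun measurableSet_Ioc fun r hr => ?_
    have hr0 : 0 ≤ T - r := sub_nonneg.2 hr.2
    simp only [le_sub_comm (a := r)]
    rw [setIntegral_Ioc_ite_le hr0 (by linarith [hr.1]), hy.2 (T - r) ⟨hr0, by linarith [hr.1]⟩,
      inner_add_left, add_sub_cancel_left,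
      inner_intervalIntegral_left _
        (hS.intervalIntegrable_conv hr0 (hf.mono_set (hsub r hr)))]
    refine intervalIntegral.integral_congr fun s hs => ?_
    rw [uIcc_of_le hr0] at hs
    rw [sub_right_comm, max_eq_left (sub_nonneg.2 hs.2)]
  have hky' : IntervalIntegrable (fun s => inner ℝ (y (T - s)) (k s)) volume 0 T :=
    hky.congr fun s _ => real_inner_comm _ _
  rw [h1, h2, intervalIntegral.integral_sub hfm hSfm, intervalIntegral.integral_sub hky' hSky]
    at hswap
  have h3 : ∫ s in (0 : ℝ)..T, inner ℝ (S (T - s) y₀) (k s) =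
      inner ℝ y₀ (∫ s in (0 : ℝ)..T, (S (T - s)).adjoint (k s)) := by
    rw [inner_intervalIntegral_right _ hSk]
    simp only [ContinuousLinearMap.adjoint_inner_right]
  rw [← inner_intervalIntegral_left _ hSf, h3] at hswap
  rw [hy.2 T hTT, hm.2 T hTT, inner_add_left, inner_add_right,
    ContinuousLinearMap.adjoint_inner_right]
  linarith

/-! ### Estimates by means of a stabilizing feedback -/

/-- If the generator of `S` is `A_R - G`, where `A_R` generates `R`, then the orbits of `R` are the
mild solutions of `y' = (A_R - G) y + G y`. -/
theorem Generates.isMildSolution_of_perturbation {A : X →ₗ.[ℝ] X} {R S : ℝ → X →L[ℝ] X}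
    (hR : Generates A R) (hS : IsC0Semigroup S) (G : X →L[ℝ] X)
    (hgen : ∀ x : A.domain,
      Tendsto (fun h : ℝ => h⁻¹ • (S h x - x)) (𝓝[>] 0) (𝓝 (A x - G x))) (x : X) (T : ℝ) :
    IsMildSolution S (fun s => G (R s x)) x T (fun s => R s x) := by
  have hRC := hR.isC0Semigroup
  have horb : ∀ x, ContinuousOn (fun s => R s x) (Icc 0 T) := fun x =>
    (hRC.continuous_orbit x).continuousOn.congr fun t ht => by
      beta_reduce
      rw [max_eq_left ht.1]
  have hdom : ∀ x ∈ A.domain, IsMildSolution S (fun s => G (R s x)) x T (fun s => R s x) := by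
    intro x hx
    have := IsMildSolution.of_hasDeriv_right (T := T) (f := fun s => G (R s x))
      (a := fun s => R s (A ⟨x, hx⟩) - G (R s x)) hS (horb x)
      (G.continuous.comp_continuousOn (horb x)) (fun s hs => ?_) (fun s hs => ?_)
    · simpa only [hRC.map_zero_apply] using this
    · obtain ⟨hx', e⟩ := hR.mem_domain (hR.tendsto_apply_orbit ⟨x, hx⟩ hs.1.le)
      rw [← e]
      exact hgen ⟨_, hx'⟩
    · rw [sub_add_cancel]
      refine (hR.tendsto_apply_orbit ⟨x, hx⟩ hs.1.le).congr' ?_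
      filter_upwards [self_mem_nhdsWithin] with h hh
      rw [add_comm s h, hRC.map_add_apply (le_of_lt hh) hs.1.le]
  refine ⟨horb x, fun t ht => ?_⟩
  have hint : ∀ x, ∫ s in (0 : ℝ)..t, S (t - s) (G (R s x)) =
      ∫ s in (0 : ℝ)..t, S (max (t - s) 0) (G (R (max s 0) x)) := by
    refine fun x => intervalIntegral.integral_congr fun s hs => ?_
    rw [uIcc_of_le ht.1] at hs
    rw [max_eq_left (sub_nonneg.2 hs.2), max_eq_left hs.1]
  -- For fixed `t` both sides of the Duhamel formula are continuous in `x`, so it extends from the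
  -- dense domain to the whole space.
  have hcont : Continuous fun x => ∫ s in (0 : ℝ)..t, S (max (t - s) 0) (G (R (max s 0) x)) := by
    refine intervalIntegral.continuous_parametric_intervalIntegral_of_continuous' ?_ 0 t
    have h1 : Continuous fun p : X × ℝ => R (max p.2 0) p.1 :=
      hRC.continuous_max.comp continuous_swap
    exact hS.continuous_max.comp ((by fun_prop : Continuous fun p : X × ℝ => t - p.2).prodMk
      (G.continuous.comp h1))
  have hclosed : IsClosed {x | R t x =
      S t x + ∫ s in (0 : ℝ)..t, S (max (t - s) 0) (G (R (max s 0) x))} :=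
    isClosed_eq (R t).continuous ((S t).continuous.add hcont)
  rw [hint]
  refine hclosed.closure_subset_iff.2 (fun z hz => ?_) (hR.dense_domain x)
  have := (hdom z hz).2 t ht
  rw [hint] at this
  exact this

/-- Cauchy–Schwarz recovered from the weighted Young inequality. The optimal weight is √b / √a;
since `a` may vanish, √a is enlarged by δ, which then tends to 0. -/
theorem le_sqrt_mul_sqrt_of_forall {x a b : ℝ} (ha : 0 ≤ a) (hb : 0 < b)
    (h : ∀ ε : ℝ, 0 < ε → x ≤ (ε * a + b / ε) / 2) : x ≤ √a * √b := by
  have hb' : 0 < √b := Real.sqrt_pos.2 hb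
  have key : ∀ δ : ℝ, 0 < δ → x ≤ (√a + δ) * √b := by
    intro δ hδ
    have hs : 0 < √a + δ := add_pos_of_nonneg_of_pos (Real.sqrt_nonneg _) hδ
    refine (h (√b / (√a + δ)) (by positivity)).trans ?_
    have h1 : √b / (√a + δ) * a ≤ √b * (√a + δ) := by
      rw [div_mul_eq_mul_div, div_le_iff₀ hs]
      have : a ≤ (√a + δ) * (√a + δ) := by
        nlinarith [Real.sq_sqrt ha, Real.sqrt_nonneg a]
      nlinarith
    have h2 : b / (√b / (√a + δ)) = √b * (√a + δ) := by
      field_simp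
      rw [Real.sq_sqrt hb.le]
    linarith
  refine le_of_forall_pos_le_add fun η hη => ?_
  refine (key (η / √b) (by positivity)).trans (le_of_eq ?_)
  field_simp

theorem integral_exp_sq_le {ω T : ℝ} (hω : 0 < ω) :
    ∫ s in (0 : ℝ)..T, Real.exp (-ω * (T - s)) ^ 2 ≤ 1 / (2 * ω) := by
  have hd : ∀ s ∈ uIcc 0 T, HasDerivAt (fun s => Real.exp (-ω * (T - s)) ^ 2 / (2 * ω))
      (Real.exp (-ω * (T - s)) ^ 2) s := by
    intro s _
    have h1 : HasDerivAt (fun s => -ω * (T - s)) ω s := by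
      simpa using ((hasDerivAt_id s).const_sub T).const_mul (-ω)
    convert! (h1.exp.pow 2).div_const (2 * ω) using 1
    field_simp
    ring_nf
  rw [intervalIntegral.integral_eq_sub_of_hasDerivAt hd
    (Continuous.intervalIntegrable (by fun_prop) _ _)]
  simp
  positivity

/-- A mild solution is controlled by its initial value and by the part of the forcing that is not
given by the feedback `G*`, if `R` is exponentially stable and the orbits of `R` solve the adjoint
equation with feedback `G`. -/
theorem IsMildSolution.norm_le_of_feedback {R S : ℝ → X →L[ℝ] X} (hS : IsC0Semigroup S)
    {G : X →L[ℝ] X} {M ω : ℝ} (hM : 0 < M) (hω : 0 < ω)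
    (hR : ∀ t, 0 ≤ t → ‖R t‖ ≤ M * Real.exp (-ω * t))
    (hRS : ∀ x T, IsMildSolution (fun t => (S t).adjoint) (fun s => G (R s x)) x T fun s => R s x)
    {T : ℝ} (hT : 0 ≤ T) {f y : ℝ → X} {y₀ : X} (hf : IntervalIntegrable f volume 0 T)
    (hy : IsMildSolution S f y₀ T y) {e : ℝ → ℝ} (he : IntervalIntegrable e volume 0 T)
    (hfe : ∀ᵐ s ∂(volume.restrict (Ioc 0 T)), ‖f s - G.adjoint (y s)‖ ^ 2 ≤ e s) :
    ‖y T‖ ≤ M * Real.exp (-ω * T) * ‖y₀‖ +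
      M * (√(∫ s in (0 : ℝ)..T, e s) * √(1 / (2 * ω))) := by
  have hE0 : 0 ≤ ∫ s in (0 : ℝ)..T, e s := by
    rw [intervalIntegral.integral_of_le hT]
    refine integral_nonneg_of_ae ?_
    filter_upwards [hfe] with s hs
    exact (sq_nonneg _).trans hs
  have key : ∀ x, inner ℝ (y T) x ≤ (M * Real.exp (-ω * T) * ‖y₀‖ +
      M * (√(∫ s in (0 : ℝ)..T, e s) * √(1 / (2 * ω)))) * ‖x‖ := by
    intro x
    have hmx := hRS x T
    have hGR : ContinuousOn (fun s => G (R s x)) (Icc 0 T) := G.continuous.comp_continuousOn hmx.1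
    have hrev : ContinuousOn (fun s => T - s) (Icc 0 T) := by fun_prop
    have hmaps : MapsTo (fun s => T - s) (Icc 0 T) (Icc 0 T) := fun s hs =>
      ⟨by linarith [hs.2], by linarith [hs.1]⟩
    have hyi : IntervalIntegrable y volume 0 T := ContinuousOn.intervalIntegrable_of_Icc hT hy.1
    -- Duality with the orbit of `R` gives ⟨y(T), x⟩ = ⟨y₀, R(T) x⟩ + ∫ ⟨f - G* y, R(T-s) x⟩ ds.
    -- Only the decay of `R` enters; no semigroup generated by A + G* is needed.
    have hd := hy.inner_sub_inner hS hT hf (ContinuousOn.intervalIntegrable_of_Icc hT hGR) hmx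
    have hsub : ∫ s in (0 : ℝ)..T, inner ℝ (y (T - s)) (G (R s x)) =
        ∫ s in (0 : ℝ)..T, inner ℝ (y s) (G (R (T - s) x)) := by
      have := intervalIntegral.integral_comp_sub_left (a := 0) (b := T)
        (fun s => inner ℝ (y s) (G (R (T - s) x))) T
      simpa using this
    have hi1 : IntervalIntegrable (fun s => inner ℝ (f s) (R (T - s) x)) volume 0 T :=
      intervalIntegrable_inner hT hf (hmx.1.comp hrev hmaps)
    have hi2 : IntervalIntegrable (fun s => inner ℝ (y s) (G (R (T - s) x))) volume 0 T :=
      intervalIntegrable_inner hT hyi (hGR.comp hrev hmaps)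
    rw [hsub, ← intervalIntegral.integral_sub hi1 hi2] at hd
    have hbound : ∫ s in (0 : ℝ)..T, (inner ℝ (f s) (R (T - s) x) -
        inner ℝ (y s) (G (R (T - s) x))) ≤
        M * ‖x‖ * (√(∫ s in (0 : ℝ)..T, e s) * √(1 / (2 * ω))) := by
      rcases (norm_nonneg x).eq_or_lt with hx | hx
      · rw [eq_comm, norm_eq_zero] at hx
        simp [hx]
      have hMx : 0 < M * ‖x‖ := mul_pos hM hx
      rw [← div_le_iff₀' hMx]
      refine le_sqrt_mul_sqrt_of_forall hE0 (by positivity) fun ε hε => ?_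
      rw [div_le_iff₀' hMx]
      have hexp : IntervalIntegrable (fun s => Real.exp (-ω * (T - s)) ^ 2) volume 0 T :=
        Continuous.intervalIntegrable (by fun_prop) _ _
      calc ∫ s in (0 : ℝ)..T, (inner ℝ (f s) (R (T - s) x) - inner ℝ (y s) (G (R (T - s) x)))
          ≤ ∫ s in (0 : ℝ)..T, M * ‖x‖ *
              ((ε * e s + Real.exp (-ω * (T - s)) ^ 2 / ε) / 2) := by
            refine intervalIntegral.integral_mono_ae_restrict hT (hi1.sub hi2)
              ((((he.const_mul ε).add (hexp.div_const ε)).div_const 2).const_mul _) ?_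
            rw [Measure.restrict_congr_set Ioc_ae_eq_Icc.symm]
            filter_upwards [hfe, ae_restrict_mem measurableSet_Ioc] with s hs hsT
            rw [← ContinuousLinearMap.adjoint_inner_left G, ← inner_sub_left]
            set w := ‖f s - G.adjoint (y s)‖
            set p := Real.exp (-ω * (T - s))
            have h1 : ‖R (T - s) x‖ ≤ M * p * ‖x‖ :=
              (R _).le_of_opNorm_le (hR _ (sub_nonneg.2 hsT.2)) x
            have h2 : w * p ≤ (ε * w ^ 2 + p ^ 2 / ε) / 2 := by
              rw [le_div_iff₀ two_pos, ← sub_nonneg]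
              have : ε * w ^ 2 + p ^ 2 / ε - w * p * 2 = (ε * w - p) ^ 2 / ε := by
                field_simp; ring
              rw [this]; positivity
            calc _ ≤ w * ‖R (T - s) x‖ := real_inner_le_norm _ _
              _ ≤ w * (M * p * ‖x‖) := by gcongr
              _ = M * ‖x‖ * (w * p) := by ring
              _ ≤ M * ‖x‖ * ((ε * w ^ 2 + p ^ 2 / ε) / 2) := by gcongr
              _ ≤ _ := by gcongr
        _ = M * ‖x‖ * ((ε * (∫ s in (0 : ℝ)..T, e s) +
              (∫ s in (0 : ℝ)..T, Real.exp (-ω * (T - s)) ^ 2) / ε) / 2) := by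
            rw [intervalIntegral.integral_const_mul, intervalIntegral.integral_div,
              intervalIntegral.integral_add (he.const_mul ε) (hexp.div_const ε),
              intervalIntegral.integral_const_mul, intervalIntegral.integral_div]
        _ ≤ _ := by gcongr; exact integral_exp_sq_le hω
    have h0 : inner ℝ y₀ (R T x) ≤ M * Real.exp (-ω * T) * ‖y₀‖ * ‖x‖ := by
      refine (real_inner_le_norm _ _).trans ?_
      have := (R T).le_of_opNorm_le (hR T hT) x
      calc ‖y₀‖ * ‖R T x‖ ≤ ‖y₀‖ * (M * Real.exp (-ω * T) * ‖x‖) := by gcongr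
        _ = _ := by ring
    linarith
  have := key (y T)
  rw [real_inner_self_eq_norm_sq, sq] at this
  rcases (norm_nonneg (y T)).eq_or_lt with h | h
  · rw [← h]; positivity
  · exact le_of_mul_le_mul_right this h

/-! ### An abstract turnpike inequality -/

/-- Pigeonhole: by monotonicity the increments over `n` consecutive steps add up to at most `E`. -/
theorem exists_small_increment {φ : ℝ → ℝ} {a b ℓ E : ℝ} {n : ℕ} (hn : 0 < n) (hℓ : 0 ≤ ℓ)
    (hφ : MonotoneOn φ (Icc a b)) (hab : a + n * ℓ ≤ b) (hE : φ b - φ a ≤ E) :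
    ∃ i < n, φ (a + (i + 1) * ℓ) - φ (a + i * ℓ) ≤ E / n := by
  by_contra! H
  have h1 : ∑ i ∈ Finset.range n, E / n <
      ∑ i ∈ Finset.range n, (φ (a + ((i + 1 : ℕ) : ℝ) * ℓ) - φ (a + (i : ℝ) * ℓ)) := by
    refine Finset.sum_lt_sum_of_nonempty (Finset.nonempty_range_iff.2 hn.ne') fun i hi => ?_
    push_cast
    exact H i (Finset.mem_range.1 hi)
  have hn' : (0 : ℝ) < n := Nat.cast_pos.2 hn
  rw [Finset.sum_range_sub (fun i : ℕ => φ (a + (i : ℝ) * ℓ)), Finset.sum_const, Finset.card_range,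
    nsmul_eq_mul, mul_div_cancel₀ _ hn'.ne'] at h1
  have hnl : 0 ≤ n * ℓ := by positivity
  have h2 := hφ ⟨by linarith, hab⟩ ⟨by linarith, le_rfl⟩ hab
  simp only [Nat.cast_zero, zero_mul, add_zero] at h1
  linarith

/-- The hypotheses of the abstract turnpike inequality: `φ` is nondecreasing and dominated by
`N₁ N₂`, while `N₁` decays forward and `N₂` decays backward in time, up to the increments of `φ`. -/
structure DecayPair (M ω κ T : ℝ) (N₁ N₂ φ : ℝ → ℝ) : Prop where
  nonneg₁ : ∀ t, 0 ≤ N₁ t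
  nonneg₂ : ∀ t, 0 ≤ N₂ t
  mono : MonotoneOn φ (Icc 0 T)
  abs_le : ∀ t ∈ Icc 0 T, |φ t| ≤ N₁ t * N₂ t
  forward : ∀ a b, 0 ≤ a → a ≤ b → b ≤ T →
    N₁ b ≤ M * Real.exp (-ω * (b - a)) * N₁ a + κ * √(φ b - φ a)
  backward : ∀ a b, 0 ≤ a → a ≤ b → b ≤ T →
    N₂ a ≤ M * Real.exp (-ω * (b - a)) * N₂ b + κ * √(φ b - φ a)

namespace DecayPair

variable {M ω κ T : ℝ} {N₁ N₂ φ : ℝ → ℝ}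

/-- Let r be the left side and g = N₁(a) + N₂(b). Then r² ≤ N₁(b) N₂(b) + N₁(a) N₂(a), and replacing
N₁(b) and N₂(a) by their decay estimates leaves r² ≤ 2 M g² + κ r g, a quadratic inequality in r. -/
theorem sqrt_increment_le (h : DecayPair M ω κ T N₁ N₂ φ) (hM : 0 < M) (hω : 0 < ω) (hκ : 0 ≤ κ)
    {a b : ℝ} (ha : 0 ≤ a) (hab : a ≤ b) (hb : b ≤ T) :
    √(φ b - φ a) ≤ (2 * M + κ + 1) * (N₁ a + N₂ b) := by
  have haT : a ∈ Icc 0 T := ⟨ha, hab.trans hb⟩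
  have hbT : b ∈ Icc 0 T := ⟨ha.trans hab, hb⟩
  have hinc : 0 ≤ φ b - φ a := sub_nonneg.2 (h.mono haT hbT hab)
  have hr := Real.sq_sqrt hinc
  have hr0 := Real.sqrt_nonneg (φ b - φ a)
  have hexp : M * Real.exp (-ω * (b - a)) ≤ M := by
    refine mul_le_of_le_one_right hM.le (Real.exp_le_one_iff.2 ?_)
    nlinarith [mul_nonneg hω.le (sub_nonneg.2 hab)]
  have hf := h.forward a b ha hab hb
  have hg := h.backward a b ha hab hb
  have h1 := (_root_.abs_le.1 (h.abs_le b hbT)).2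
  have h2 := (_root_.abs_le.1 (h.abs_le a haT)).1
  have ha1 := h.nonneg₁ a
  have hb2 := h.nonneg₂ b
  set r := √(φ b - φ a)
  have hf' : N₁ b ≤ M * N₁ a + κ * r := hf.trans (by gcongr)
  have hg' : N₂ a ≤ M * N₂ b + κ * r := hg.trans (by gcongr)
  have h3 : N₁ b * N₂ b ≤ (M * N₁ a + κ * r) * N₂ b := by gcongr
  have h4 : N₁ a * N₂ a ≤ N₁ a * (M * N₂ b + κ * r) := by gcongr
  set g := N₁ a + N₂ b with hg_def
  have hg0 : 0 ≤ g := add_nonneg ha1 hb2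
  have hkey : r ^ 2 ≤ 2 * M * g ^ 2 + κ * r * g := by
    have : N₁ a * N₂ b ≤ g ^ 2 := by rw [hg_def]; nlinarith [mul_nonneg ha1 hb2]
    have h5 : M * (N₁ a * N₂ b) ≤ M * g ^ 2 := by gcongr
    calc r ^ 2 ≤ 2 * (M * (N₁ a * N₂ b)) + κ * r * g := by rw [hr, hg_def]; linarith
      _ ≤ _ := by linarith
  -- If r ≤ g there is nothing to do; otherwise g² ≤ g r and one factor r is divided out.
  rcases le_total r g with hrg | hrg
  · exact hrg.trans (le_mul_of_one_le_left hg0 (by linarith))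
  · rcases hr0.eq_or_lt with h0 | h0
    · rw [← h0]; positivity
    · refine le_of_mul_le_mul_right ?_ h0
      have : g ^ 2 ≤ g * r := by rw [sq]; gcongr
      have h6 : 2 * M * g ^ 2 ≤ 2 * M * (g * r) := by gcongr
      nlinarith [mul_nonneg hg0 hr0]

/-- By monotonicity the increment over a subinterval is at most the one over [a, b], so the
preceding bound serves at every intermediate time, with a constant independent of b - a. -/
theorem le_endpoints (h : DecayPair M ω κ T N₁ N₂ φ) (hM : 0 < M) (hω : 0 < ω) (hκ : 0 ≤ κ)
    {a b t : ℝ} (ha : 0 ≤ a) (hb : b ≤ T) (hat : a ≤ t) (htb : t ≤ b) :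
    N₁ t ≤ (M + κ * (2 * M + κ + 1)) * (N₁ a + N₂ b) ∧
      N₂ t ≤ (M + κ * (2 * M + κ + 1)) * (N₁ a + N₂ b) := by
  have haT : a ∈ Icc 0 T := ⟨ha, by linarith⟩
  have hbT : b ∈ Icc 0 T := ⟨by linarith, hb⟩
  have htT : t ∈ Icc 0 T := ⟨by linarith, by linarith⟩
  have hr := h.sqrt_increment_le hM hω hκ ha (hat.trans htb) hb
  have hexp : ∀ x : ℝ, 0 ≤ x → M * Real.exp (-ω * x) ≤ M := fun x hx =>
    mul_le_of_le_one_right hM.le (Real.exp_le_one_iff.2 (by nlinarith [mul_nonneg hω.le hx]))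
  have ha1 := h.nonneg₁ a
  have hb2 := h.nonneg₂ b
  constructor
  · calc N₁ t ≤ M * Real.exp (-ω * (t - a)) * N₁ a + κ * √(φ t - φ a) :=
          h.forward a t ha hat (by linarith)
      _ ≤ M * (N₁ a + N₂ b) + κ * √(φ b - φ a) := by
          have := h.mono htT hbT htb
          gcongr
          · exact hexp _ (sub_nonneg.2 hat)
          · linarith
      _ ≤ M * (N₁ a + N₂ b) + κ * ((2 * M + κ + 1) * (N₁ a + N₂ b)) := by gcongr
      _ = _ := by ring
  · calc N₂ t ≤ M * Real.exp (-ω * (b - t)) * N₂ b + κ * √(φ b - φ t) :=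
          h.backward t b (by linarith) htb hb
      _ ≤ M * (N₁ a + N₂ b) + κ * √(φ b - φ a) := by
          have := h.mono haT htT hat
          gcongr
          · exact hexp _ (sub_nonneg.2 htb)
          · linarith
      _ ≤ M * (N₁ a + N₂ b) + κ * ((2 * M + κ + 1) * (N₁ a + N₂ b)) := by gcongr
      _ = _ := by ring

/-- In each end block a step with little increment is selected. There the exponential factor is
small because ℓ is large, and the increment term because n is large. Each of the four resulting
terms is at most g / 8. -/
theorem exists_halving (h : DecayPair M ω κ T N₁ N₂ φ) (hM : 0 < M) (hω : 0 < ω) (hκ : 0 ≤ κ)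
    {ℓ : ℝ} {n : ℕ} (hℓ : 0 < ℓ) (hn : 0 < n)
    (hℓ' : M * Real.exp (-ω * ℓ) * (M + κ * (2 * M + κ + 1)) ≤ 1 / 8)
    (hn' : κ * (2 * M + κ + 1) / √n ≤ 1 / 8)
    {a b : ℝ} (ha : 0 ≤ a) (hb : b ≤ T) (hab : a + 2 * (n * ℓ) ≤ b) :
    ∃ a' b', a ≤ a' ∧ a' ≤ a + n * ℓ ∧ b - n * ℓ ≤ b' ∧ b' ≤ b ∧
      N₁ a' + N₂ b' ≤ (N₁ a + N₂ b) / 2 := by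
  have hnl : 0 ≤ n * ℓ := by positivity
  have hab' : a ≤ b := by linarith
  have hr := h.sqrt_increment_le hM hω hκ ha hab' hb
  set g := N₁ a + N₂ b with hg_def
  have hg0 : 0 ≤ g := add_nonneg (h.nonneg₁ a) (h.nonneg₂ b)
  have hmono : MonotoneOn φ (Icc a b) := h.mono.mono (Icc_subset_Icc ha hb)
  obtain ⟨i, hi, hi'⟩ := exists_small_increment hn hℓ.le hmono (by linarith : a + n * ℓ ≤ b) le_rfl
  have hmem : b - n * ℓ ∈ Icc a b := ⟨by linarith, by linarith⟩
  -- Needed to bound the increment over the right block by the one over [a, b].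
  have hφ := hmono ⟨le_rfl, hab'⟩ hmem hmem.1
  obtain ⟨j, hj, hj'⟩ := exists_small_increment (a := b - n * ℓ) (E := φ b - φ a) hn hℓ.le
    (hmono.mono (Icc_subset_Icc_left (by linarith))) (by linarith : b - n * ℓ + n * ℓ ≤ b)
    (by linarith)
  have hi1 : ((i : ℝ) + 1) * ℓ ≤ n * ℓ := by gcongr; exact_mod_cast hi
  have hj1 : ((j : ℝ) + 1) * ℓ ≤ n * ℓ := by gcongr; exact_mod_cast hj
  have hi0 : 0 ≤ (i : ℝ) * ℓ := by positivity
  have hj0 : 0 ≤ (j : ℝ) * ℓ := by positivity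
  have hsq : ∀ x, x ≤ (φ b - φ a) / n → κ * √x ≤ 1 / 8 * g := by
    intro x hx
    calc κ * √x ≤ κ * √((φ b - φ a) / n) := by gcongr
      _ = κ * (√(φ b - φ a) / √n) := by rw [Real.sqrt_div' _ (Nat.cast_nonneg n)]
      _ ≤ κ * (((2 * M + κ + 1) * g) / √n) := by gcongr
      _ = κ * (2 * M + κ + 1) / √n * g := by ring
      _ ≤ 1 / 8 * g := by gcongr
  have hdec : ∀ N, N ≤ (M + κ * (2 * M + κ + 1)) * g → M * Real.exp (-ω * ℓ) * N ≤ 1 / 8 * g := by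
    intro N hN
    calc M * Real.exp (-ω * ℓ) * N ≤ M * Real.exp (-ω * ℓ) * ((M + κ * (2 * M + κ + 1)) * g) := by
          gcongr
      _ = M * Real.exp (-ω * ℓ) * (M + κ * (2 * M + κ + 1)) * g := by ring
      _ ≤ 1 / 8 * g := by gcongr
  -- N₁ is read at the right end of its step and N₂ at the left end of its step, each after the
  -- decay has acted.
  refine ⟨a + (i + 1) * ℓ, b - n * ℓ + j * ℓ, by linarith, by linarith, by linarith, by linarith, ?_⟩
  have h1 := h.forward (a + i * ℓ) (a + (i + 1) * ℓ) (by linarith) (by linarith) (by linarith)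
  have h2 := h.backward (b - n * ℓ + j * ℓ) (b - n * ℓ + (j + 1) * ℓ) (by linarith) (by linarith)
    (by linarith)
  rw [show a + (i + 1) * ℓ - (a + i * ℓ) = ℓ by ring] at h1
  rw [show b - n * ℓ + (j + 1) * ℓ - (b - n * ℓ + j * ℓ) = ℓ by ring] at h2
  have h3 := hdec _ (h.le_endpoints hM hω hκ (t := a + i * ℓ) ha hb (by linarith) (by linarith)).1
  have h4 := hdec _ (h.le_endpoints hM hω hκ (t := b - n * ℓ + (j + 1) * ℓ) ha hb (by linarith)
    (by linarith)).2
  linarith [hsq _ hi', hsq _ hj']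

theorem le_geometric (h : DecayPair M ω κ T N₁ N₂ φ) (hM : 0 < M) (hω : 0 < ω) (hκ : 0 ≤ κ)
    {ℓ : ℝ} {n : ℕ} (hℓ : 0 < ℓ) (hn : 0 < n)
    (hℓ' : M * Real.exp (-ω * ℓ) * (M + κ * (2 * M + κ + 1)) ≤ 1 / 8)
    (hn' : κ * (2 * M + κ + 1) / √n ≤ 1 / 8) (k : ℕ) :
    ∀ a b t : ℝ, 0 ≤ a → b ≤ T → a + k * (n * ℓ) ≤ t → t ≤ b - k * (n * ℓ) →
      N₁ t + N₂ t ≤ 2 * (M + κ * (2 * M + κ + 1)) * (N₁ a + N₂ b) * (1 / 2) ^ k := by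
  induction k with
  | zero =>
    intro a b t ha hb hat htb
    simp only [Nat.cast_zero, zero_mul, add_zero, sub_zero] at hat htb
    have := h.le_endpoints hM hω hκ ha hb hat htb
    rw [pow_zero]
    linarith [this.1, this.2]
  | succ k ih =>
    intro a b t ha hb hat htb
    push_cast at hat htb
    have hnl : 0 ≤ n * ℓ := by positivity
    have hkl : 0 ≤ k * (n * ℓ) := by positivity
    obtain ⟨a', b', h1, h2, h3, h4, h5⟩ :=
      h.exists_halving hM hω hκ hℓ hn hℓ' hn' ha hb (by linarith)
    refine (ih a' b' t (by linarith) (by linarith) (by linarith) (by linarith)).trans ?_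
    calc _ ≤ 2 * (M + κ * (2 * M + κ + 1)) * ((N₁ a + N₂ b) / 2) * (1 / 2) ^ k := by gcongr
      _ = _ := by rw [pow_succ]; ring

end DecayPair

/-- The parameters ℓ and n depend on M, ω, κ only. With L = n ℓ and m the distance from t to the
nearer end, ⌊m / L⌋ halvings are available, and (1/2)^⌊m/L⌋ ≤ 2 exp(-(log 2 / L) m). -/
theorem exists_decayPair_bound {M ω κ : ℝ} (hM : 0 < M) (hω : 0 < ω) (hκ : 0 ≤ κ) :
    ∃ c ν : ℝ, 0 < c ∧ 0 < ν ∧ ∀ (T : ℝ) (N₁ N₂ φ : ℝ → ℝ), DecayPair M ω κ T N₁ N₂ φ →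
      ∀ t ∈ Icc 0 T, N₁ t + N₂ t ≤
        c * (N₁ 0 + N₂ T) * (Real.exp (-ν * t) + Real.exp (-ν * (T - t))) := by
  obtain ⟨ℓ, hℓ, hℓ'⟩ : ∃ ℓ : ℝ, 0 < ℓ ∧
      M * Real.exp (-ω * ℓ) * (M + κ * (2 * M + κ + 1)) ≤ 1 / 8 := by
    have hlim : Tendsto (fun ℓ : ℝ => M * Real.exp (-(ω * ℓ)) * (M + κ * (2 * M + κ + 1))) atTop
        (𝓝 (M * 0 * (M + κ * (2 * M + κ + 1)))) :=
      ((Real.tendsto_exp_neg_atTop_nhds_zero.comp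
        (tendsto_id.const_mul_atTop hω)).const_mul M).mul_const _
    rw [mul_zero, zero_mul] at hlim
    obtain ⟨ℓ, h1, h2⟩ := ((hlim.eventually_le_const (by norm_num : (0 : ℝ) < 1 / 8)).and
      (eventually_gt_atTop 0)).exists
    exact ⟨ℓ, h2, by rwa [neg_mul]⟩
  obtain ⟨n, hn, hn'⟩ : ∃ n : ℕ, 0 < n ∧ κ * (2 * M + κ + 1) / √n ≤ 1 / 8 := by
    have hlim : Tendsto (fun n : ℕ => κ * (2 * M + κ + 1) / √(n : ℝ)) atTop (𝓝 0) :=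
      (Real.tendsto_sqrt_atTop.comp tendsto_natCast_atTop_atTop).const_div_atTop _
    obtain ⟨n, h1, h2⟩ := ((hlim.eventually_le_const (by norm_num : (0 : ℝ) < 1 / 8)).and
      (eventually_gt_atTop 0)).exists
    exact ⟨n, h2, h1⟩
  have hL : 0 < n * ℓ := mul_pos (Nat.cast_pos.2 hn) hℓ
  refine ⟨4 * (M + κ * (2 * M + κ + 1)), Real.log 2 / (n * ℓ), by positivity,
    div_pos (Real.log_pos one_lt_two) hL, fun T N₁ N₂ φ h t ht => ?_⟩
  set L := n * ℓ
  set m := min t (T - t)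
  have hm0 : 0 ≤ m := le_min ht.1 (sub_nonneg.2 ht.2)
  set k := ⌊m / L⌋₊
  have hk : k * L ≤ m := by
    rw [← le_div_iff₀ hL]; exact Nat.floor_le (by positivity)
  have hk' : m / L - 1 ≤ k := by linarith [Nat.lt_floor_add_one (m / L)]
  have h1 := h.le_geometric hM hω hκ hℓ hn hℓ' hn' k 0 T t le_rfl le_rfl
    (by linarith [min_le_left t (T - t)]) (by linarith [min_le_right t (T - t)])
  have hpow : (1 / 2 : ℝ) ^ k ≤ 2 * Real.exp (-(Real.log 2 / L) * m) := by
    have e1 : (1 / 2 : ℝ) ^ k = Real.exp (-(k * Real.log 2)) := by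
      rw [Real.exp_neg, mul_comm, Real.exp_mul, Real.exp_log two_pos, Real.rpow_natCast]
      simp
    have e2 : 2 * Real.exp (-(Real.log 2 / L) * m) = Real.exp (-((m / L - 1) * Real.log 2)) := by
      nth_rw 1 [← Real.exp_log two_pos, ← Real.exp_add]
      congr 1; ring
    rw [e1, e2]
    gcongr
  have hexp : Real.exp (-(Real.log 2 / L) * m) ≤
      Real.exp (-(Real.log 2 / L) * t) + Real.exp (-(Real.log 2 / L) * (T - t)) := by
    rcases min_choice t (T - t) with hc | hc
    · rw [show m = t from hc]; linarith [Real.exp_pos (-(Real.log 2 / L) * (T - t))]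
    · rw [show m = T - t from hc]; linarith [Real.exp_pos (-(Real.log 2 / L) * t)]
  have hg := add_nonneg (h.nonneg₁ 0) (h.nonneg₂ T)
  refine h1.trans ?_
  calc _ ≤ 2 * (M + κ * (2 * M + κ + 1)) * (N₁ 0 + N₂ T) *
        (2 * (Real.exp (-(Real.log 2 / L) * t) + Real.exp (-(Real.log 2 / L) * (T - t)))) := by
        gcongr
        exact hpow.trans (by gcongr)
    _ = _ := by ring

/-! ### Extremals decay from both ends -/

/-- Positivity of Q at v - q⁻¹ Q v gives ‖Q v‖² ≤ q ⟨Q v, v⟩, and invertibility gives ‖v‖ ≤ r ‖Q v‖.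
The summands 1 keep q and r positive even when U is trivial. -/
theorem exists_coercive (Q : U ≃L[ℝ] U) (hQ : (Q : U →L[ℝ] U).IsPositive) :
    ∃ α : ℝ, 0 < α ∧ ∀ v, α * ‖v‖ ^ 2 ≤ inner ℝ (Q v) v := by
  set q := ‖(Q : U →L[ℝ] U)‖ + 1
  set r := ‖(Q.symm : U →L[ℝ] U)‖ + 1
  have hq : 0 < q := by positivity
  have hr : 0 < r := by positivity
  have hsymm : ∀ v w, inner ℝ (Q v) w = inner ℝ v (Q w) := fun v w => hQ.1 v w
  have hpos : ∀ v, 0 ≤ inner ℝ (Q v) v := fun v => hQ.2 v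
  refine ⟨1 / (q * r ^ 2), by positivity, fun v => ?_⟩
  have h1 : ‖v‖ ≤ r * ‖Q v‖ := by
    have := (Q.symm : U →L[ℝ] U).le_of_opNorm_le (c := r) (by simp [r]) (Q v)
    simpa using this
  have h2 : ‖Q (Q v)‖ ≤ q * ‖Q v‖ :=
    (Q : U →L[ℝ] U).le_of_opNorm_le (c := q) (by simp [q]) (Q v)
  have h3 : ‖Q v‖ ^ 2 ≤ q * inner ℝ (Q v) v := by
    have h := hpos (v - q⁻¹ • Q v)
    rw [map_sub, map_smul, inner_sub_left, inner_sub_right, inner_sub_right, inner_smul_left,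
      inner_smul_left, inner_smul_right, inner_smul_right, hsymm (Q v) v,
      real_inner_self_eq_norm_sq] at h
    simp only [conj_trivial] at h
    have h4 : inner ℝ (Q (Q v)) (Q v) ≤ q * ‖Q v‖ ^ 2 := by
      refine (real_inner_le_norm _ _).trans ?_
      rw [sq, ← mul_assoc]; gcongr
    have h5 : q⁻¹ * (q⁻¹ * inner ℝ (Q (Q v)) (Q v)) ≤ q⁻¹ * ‖Q v‖ ^ 2 := by
      gcongr
      rw [inv_mul_le_iff₀ hq]; exact h4
    rw [← inv_mul_le_iff₀ hq]
    linarith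
  rw [one_div, inv_mul_le_iff₀ (by positivity)]
  calc ‖v‖ ^ 2 ≤ (r * ‖Q v‖) ^ 2 := by gcongr
    _ = r ^ 2 * ‖Q v‖ ^ 2 := by ring
    _ ≤ r ^ 2 * (q * inner ℝ (Q v) v) := by gcongr
    _ = _ := by ring

theorem norm_sub_sq_le (a b : X) : ‖a - b‖ ^ 2 ≤ 2 * ‖a‖ ^ 2 + 2 * ‖b‖ ^ 2 := by
  have h1 := norm_sub_le a b
  nlinarith [norm_nonneg (a - b), sq_nonneg (‖a‖ - ‖b‖), norm_nonneg a, norm_nonneg b]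

/-- The constant γ is such that the square of each forcing left after feedback is at most γ times
the density e = ⟨Q v, v⟩ + ‖C x‖², whose integral is the increment of ⟨x, p⟩. -/
theorem decayPair_of_extremal {S R₁ R₂ : ℝ → X →L[ℝ] X} (hS : IsC0Semigroup S)
    {B : U →L[ℝ] X} {C : X →L[ℝ] V} {Q : U ≃L[ℝ] U} {α : ℝ} (hα : 0 < α)
    (hQ : ∀ v, α * ‖v‖ ^ 2 ≤ inner ℝ (Q v) v) {K₁ : X →L[ℝ] V} {K₂ : X →L[ℝ] U}
    {M ω γ : ℝ} (hM : 0 < M) (hω : 0 < ω)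
    (hγ₁ : 2 * ‖B‖ ^ 2 ≤ γ * α) (hγ₂ : 2 * ‖K₁‖ ^ 2 ≤ γ) (hγ₃ : 2 * ‖C‖ ^ 2 ≤ γ)
    (hγ₄ : 2 * (‖K₂‖ * ‖(Q : U →L[ℝ] U)‖) ^ 2 ≤ γ * α)
    (hR₁ : ∀ t, 0 ≤ t → ‖R₁ t‖ ≤ M * Real.exp (-ω * t))
    (hR₂ : ∀ t, 0 ≤ t → ‖R₂ t‖ ≤ M * Real.exp (-ω * t))
    (hRS₁ : ∀ x T, IsMildSolution (fun t => (S t).adjoint)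
      (fun s => (C.adjoint.comp K₁) (R₁ s x)) x T fun s => R₁ s x)
    (hRS₂ : ∀ x T, IsMildSolution S (fun s => (B.comp K₂) (R₂ s x)) x T fun s => R₂ s x)
    {T : ℝ} {x p : ℝ → X} {x₀ m₀ : X} (hp : ContinuousOn p (Icc 0 T))
    (hx : IsMildSolution S (fun s => B (Q.symm (B.adjoint (p s)))) x₀ T x)
    (hm : IsMildSolution (fun t => (S t).adjoint) (fun s => -C.adjoint (C (x (T - s)))) m₀ T
      fun t => p (T - t)) :
    DecayPair M ω (M * (√γ * √(1 / (2 * ω)))) T (fun t => ‖x t‖) (fun t => ‖p t‖)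
      (fun t => inner ℝ (x t) (p t)) := by
  set v : ℝ → U := fun s => Q.symm (B.adjoint (p s)) with hv_def
  have hQv : ∀ s, Q (v s) = B.adjoint (p s) := fun s => Q.apply_symm_apply _
  have hγ : 0 ≤ γ := by nlinarith [sq_nonneg ‖K₁‖]
  have hv : ContinuousOn v (Icc 0 T) :=
    Q.symm.continuous.comp_continuousOn (B.adjoint.continuous.comp_continuousOn hp)
  set e : ℝ → ℝ := fun s => inner ℝ (Q (v s)) (v s) + ‖C (x s)‖ ^ 2 with he_def
  have he : ContinuousOn e (Icc 0 T) :=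
    ((Q.continuous.comp_continuousOn hv).inner hv).add
      ((C.continuous.comp_continuousOn hx.1).norm.pow 2)
  have he0 : ∀ s, 0 ≤ e s := fun s =>
    add_nonneg ((by positivity : 0 ≤ α * ‖v s‖ ^ 2).trans (hQ _)) (sq_nonneg _)
  have hBv : ContinuousOn (fun s => B (v s)) (Icc 0 T) := B.continuous.comp_continuousOn hv
  have hk : ContinuousOn (fun s => -C.adjoint (C (x (T - s)))) (Icc 0 T) :=
    (C.adjoint.continuous.comp_continuousOn (C.continuous.comp_continuousOn
      (hx.1.comp (by fun_prop) fun s hs => ⟨by linarith [hs.2], by linarith [hs.1]⟩))).neg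
  have hfwd : ∀ a b, 0 ≤ a → a ≤ b → b ≤ T →
      IsMildSolution S (fun s => B (v (a + s))) (x a) (b - a) fun s => x (a + s) :=
    fun a b ha hab hb => hx.restrict hS
      (hBv.intervalIntegrable_of_Icc (ha.trans (hab.trans hb))) ha hb
  have hbwd : ∀ a b, 0 ≤ a → a ≤ b → b ≤ T →
      IsMildSolution (fun t => (S t).adjoint) (fun s => -C.adjoint (C (x (b - s)))) (p b) (b - a)
        fun s => p (b - s) := by
    intro a b ha hab hb
    -- In reversed time [a, b] becomes [T - b, T - a].
    have := hm.restrict hS.adjoint (hk.intervalIntegrable_of_Icc (ha.trans (hab.trans hb)))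
      (sub_nonneg.2 hb) (by linarith : T - a ≤ T)
    simpa only [sub_sub_sub_cancel_left, sub_sub_cancel, ← sub_sub] using this
  have hfwdi : ∀ a b, 0 ≤ a → a ≤ b → b ≤ T →
      IntervalIntegrable (fun s => B (v (a + s))) volume 0 (b - a) := fun a b ha hab hb =>
    (hBv.comp (by fun_prop) fun s hs => ⟨by linarith [hs.1], by linarith [hs.2]⟩ :
      ContinuousOn ((fun s => B (v s)) ∘ fun s => a + s) (Icc 0 (b - a))).intervalIntegrable_of_Icc
        (sub_nonneg.2 hab)
  have hbwdi : ∀ a b, 0 ≤ a → a ≤ b → b ≤ T →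
      IntervalIntegrable (fun s => -C.adjoint (C (x (b - s)))) volume 0 (b - a) :=
    fun a b ha hab hb => ContinuousOn.intervalIntegrable_of_Icc (sub_nonneg.2 hab)
      (C.adjoint.continuous.comp_continuousOn (C.continuous.comp_continuousOn
      (hx.1.comp (by fun_prop) fun s hs => ⟨by linarith [hs.2], by linarith [hs.1]⟩))).neg
  have hef : ∀ a b, ∫ s in (0 : ℝ)..(b - a), e (a + s) = ∫ s in a..b, e s := fun a b => by
    rw [intervalIntegral.integral_comp_add_left]; simp
  have heb : ∀ a b, ∫ s in (0 : ℝ)..(b - a), e (b - s) = ∫ s in a..b, e s := fun a b => by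
    rw [intervalIntegral.integral_comp_sub_left]; simp
  -- Energy identity: duality on [a, b], with ⟨B v, p⟩ = ⟨v, B* p⟩ = ⟨Q v, v⟩.
  have henergy : ∀ a b, 0 ≤ a → a ≤ b → b ≤ T →
      inner ℝ (x b) (p b) - inner ℝ (x a) (p a) = ∫ s in a..b, e s := by
    intro a b ha hab hb
    have h := (hfwd a b ha hab hb).inner_sub_inner hS (sub_nonneg.2 hab) (hfwdi a b ha hab hb)
      (hbwdi a b ha hab hb) (hbwd a b ha hab hb)
    simp only [add_sub_cancel, sub_sub_cancel, inner_neg_right, intervalIntegral.integral_neg,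
      sub_neg_eq_add, ContinuousLinearMap.adjoint_inner_right] at h
    have h1 : ∀ s, b - (b - a - s) = a + s := fun s => by ring
    have h2 : ∀ s, a + (b - a - s) = b - s := fun s => by ring
    simp only [h1, h2, real_inner_self_eq_norm_sq] at h
    rw [h]
    have i1 := intervalIntegral.integral_comp_add_left (a := 0) (b := b - a)
      (fun s => inner ℝ (B (v s)) (p s)) a
    have i2 := intervalIntegral.integral_comp_sub_left (a := 0) (b := b - a)
      (fun s => ‖C (x s)‖ ^ 2) b
    simp only [add_zero, add_sub_cancel, sub_zero, sub_sub_cancel] at i1 i2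
    have hsub := Icc_subset_Icc ha hb
    rw [i1, i2, ← intervalIntegral.integral_add]
    · simp only [he_def, hQv, ContinuousLinearMap.adjoint_inner_left, real_inner_comm]
    · exact ((hBv.mono hsub).inner (hp.mono hsub)).intervalIntegrable_of_Icc hab
    · exact ((C.continuous.comp_continuousOn
        (hx.1.mono hsub)).norm.pow 2).intervalIntegrable_of_Icc hab
  have hκ : ∀ E : ℝ, M * (√(γ * E) * √(1 / (2 * ω))) = M * (√γ * √(1 / (2 * ω))) * √E := by
    intro E; rw [Real.sqrt_mul hγ]; ring
  have hγv : ∀ (c : ℝ) s, c ≤ γ * α → c * ‖v s‖ ^ 2 ≤ γ * inner ℝ (Q (v s)) (v s) := by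
    intro c s hc
    calc c * ‖v s‖ ^ 2 ≤ γ * α * ‖v s‖ ^ 2 := by gcongr
      _ = γ * (α * ‖v s‖ ^ 2) := by ring
      _ ≤ _ := by gcongr; exact hQ _
  refine ⟨fun t => norm_nonneg _, fun t => norm_nonneg _, fun a ha b hb hab => ?_,
    fun t _ => abs_real_inner_le_norm _ _, fun a b ha hab hb => ?_, fun a b ha hab hb => ?_⟩
  · rw [← sub_nonneg, henergy a b ha.1 hab hb.2]
    exact intervalIntegral.integral_nonneg hab fun s _ => he0 s
  -- Here G = C* K₁, so the remaining forcing is B v - K₁* C x.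
  · have h := (hfwd a b ha hab hb).norm_le_of_feedback hS hM hω hR₁ hRS₁ (sub_nonneg.2 hab)
      (hfwdi a b ha hab hb) (e := fun s => γ * e (a + s)) ?_ (Eventually.of_forall fun s => ?_)
    · rw [intervalIntegral.integral_const_mul, hef, hκ, ← henergy a b ha hab hb,
        add_sub_cancel] at h
      exact h
    · refine IntervalIntegrable.const_mul ?_ _
      exact ContinuousOn.intervalIntegrable_of_Icc (sub_nonneg.2 hab)
        (he.comp (by fun_prop) fun s hs => ⟨by linarith [hs.1], by linarith [hs.2]⟩)
    · rw [ContinuousLinearMap.adjoint_comp, ContinuousLinearMap.adjoint_adjoint,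
        ContinuousLinearMap.comp_apply]
      refine (norm_sub_sq_le _ _).trans ?_
      have h1 : ‖B (v (a + s))‖ ≤ ‖B‖ * ‖v (a + s)‖ := B.le_opNorm _
      have h2 : ‖K₁.adjoint (C (x (a + s)))‖ ≤ ‖K₁‖ * ‖C (x (a + s))‖ :=
        ContinuousLinearMap.le_of_opNorm_le _ (by rw [LinearIsometryEquiv.norm_map]) _
      calc _ ≤ 2 * (‖B‖ * ‖v (a + s)‖) ^ 2 + 2 * (‖K₁‖ * ‖C (x (a + s))‖) ^ 2 := by gcongr
        _ = 2 * ‖B‖ ^ 2 * ‖v (a + s)‖ ^ 2 + 2 * ‖K₁‖ ^ 2 * ‖C (x (a + s))‖ ^ 2 := by ring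
        _ ≤ γ * inner ℝ (Q (v (a + s))) (v (a + s)) + γ * ‖C (x (a + s))‖ ^ 2 := by
            gcongr ?_ + ?_ * _; exact hγv _ _ hγ₁
        _ = _ := by rw [he_def]; ring
  -- Here G = B K₂, and the remaining forcing -C*C x - K₂* B* p is controlled by e because B* p = Q
  -- v.
  · have h := (hbwd a b ha hab hb).norm_le_of_feedback hS.adjoint hM hω hR₂ (G := B.comp K₂)
      (by simpa only [ContinuousLinearMap.adjoint_adjoint] using hRS₂) (sub_nonneg.2 hab)
      (hbwdi a b ha hab hb) (e := fun s => γ * e (b - s)) ?_ (Eventually.of_forall fun s => ?_)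
    · rw [intervalIntegral.integral_const_mul, heb, hκ, ← henergy a b ha hab hb,
        sub_sub_cancel] at h
      exact h
    · refine IntervalIntegrable.const_mul ?_ _
      exact ContinuousOn.intervalIntegrable_of_Icc (sub_nonneg.2 hab)
        (he.comp (by fun_prop) fun s hs => ⟨by linarith [hs.2], by linarith [hs.1]⟩)
    · rw [ContinuousLinearMap.adjoint_comp, ContinuousLinearMap.comp_apply, ← hQv]
      refine (norm_sub_sq_le _ _).trans ?_
      rw [norm_neg]
      have h1 : ‖C.adjoint (C (x (b - s)))‖ ≤ ‖C‖ * ‖C (x (b - s))‖ :=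
        ContinuousLinearMap.le_of_opNorm_le _ (by rw [LinearIsometryEquiv.norm_map]) _
      have h2 : ‖K₂.adjoint (Q (v (b - s)))‖ ≤ ‖K₂‖ * (‖(Q : U →L[ℝ] U)‖ * ‖v (b - s)‖) :=
        (ContinuousLinearMap.le_of_opNorm_le _ (by rw [LinearIsometryEquiv.norm_map]) _).trans
          (by gcongr; exact (Q : U →L[ℝ] U).le_opNorm _)
      calc _ ≤ 2 * (‖C‖ * ‖C (x (b - s))‖) ^ 2 +
            2 * (‖K₂‖ * (‖(Q : U →L[ℝ] U)‖ * ‖v (b - s)‖)) ^ 2 := by gcongr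
        _ = 2 * (‖K₂‖ * ‖(Q : U →L[ℝ] U)‖) ^ 2 * ‖v (b - s)‖ ^ 2 +
            2 * ‖C‖ ^ 2 * ‖C (x (b - s))‖ ^ 2 := by ring
        _ ≤ γ * inner ℝ (Q (v (b - s))) (v (b - s)) + γ * ‖C (x (b - s))‖ ^ 2 := by
            gcongr ?_ + ?_ * _; exact hγv _ _ hγ₄
        _ = _ := by rw [he_def]; ring

/-! ### First order optimality conditions -/

theorem integrable_inner_of_memLp {μ : Measure ℝ} {f g : ℝ → X} (hf : MemLp f 2 μ)
    (hg : MemLp g 2 μ) : Integrable (fun s => inner ℝ (f s) (g s)) μ := by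
  refine Integrable.mono' (hf.norm.integrable_sq.add hg.norm.integrable_sq)
    (hf.aestronglyMeasurable.inner hg.aestronglyMeasurable) (Eventually.of_forall fun s => ?_)
  refine (norm_inner_le_norm _ _).trans ?_
  simp only [Pi.add_apply]
  nlinarith [sq_nonneg (‖f s‖ - ‖g s‖), sq_nonneg ‖f s‖, sq_nonneg ‖g s‖]

theorem memLp_of_continuousOn {g : ℝ → X} {T : ℝ} (hg : ContinuousOn g (Icc 0 T)) :
    MemLp g 2 (volume.restrict (Ioc 0 T)) := by
  obtain ⟨K, hK⟩ := isCompact_Icc.exists_bound_of_continuousOn hg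
  refine MemLp.of_bound ((hg.mono Ioc_subset_Icc_self).aestronglyMeasurable measurableSet_Ioc) K ?_
  filter_upwards [ae_restrict_mem measurableSet_Ioc] with s hs
  exact hK s (Ioc_subset_Icc_self hs)

theorem eq_zero_of_forall_nonneg {a b : ℝ} (h : ∀ ε : ℝ, 0 ≤ ε * a + ε ^ 2 * b) : a = 0 := by
  -- For this small ε of sign opposite to `a`, the linear term dominates and the sum is negative
  -- unless `a = 0`.
  have h1 := h (-a / (2 * (|b| + 1)))
  have hb : 0 < |b| + 1 := by positivity
  have e : -a / (2 * (|b| + 1)) * a + (-a / (2 * (|b| + 1))) ^ 2 * b =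
      a ^ 2 * (b - 2 * (|b| + 1)) / (4 * (|b| + 1) ^ 2) := by
    field_simp; ring
  rw [e, le_div_iff₀ (by positivity), zero_mul] at h1
  have h2 : b - 2 * (|b| + 1) < 0 := by linarith [le_abs_self b]
  by_contra ha
  have : 0 < a ^ 2 := by positivity
  nlinarith

theorem runningCost_add_smul {C : X →L[ℝ] V} {Q : U ≃L[ℝ] U} (hQ : (Q : U →L[ℝ] U).IsPositive)
    (y_d : X) (u_d : U) (y w : X) (u v : U) (ε : ℝ) :
    runningCost C Q y_d u_d (y + ε • w) (u + ε • v) = runningCost C Q y_d u_d y u +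
      (ε * (inner ℝ (C (y - y_d)) (C w) + inner ℝ (Q (u - u_d)) v) +
        ε ^ 2 * ((1 / 2) * (inner ℝ (C w) (C w) + inner ℝ (Q v) v))) := by
  have h1 : C (y + ε • w - y_d) = C (y - y_d) + ε • C w := by
    rw [← map_smul, ← map_add]; congr 1; abel
  have h2 : u + ε • v - u_d = (u - u_d) + ε • v := by abel
  have h3 : inner ℝ (Q v) (u - u_d) = inner ℝ (Q (u - u_d)) v := by
    rw [real_inner_comm]; exact (hQ.1 (u - u_d) v).symm
  simp only [runningCost]
  rw [h1, h2, map_add, map_smul, norm_add_sq_real, inner_add_left, inner_add_right,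
    inner_add_right, inner_smul_left, inner_smul_right, inner_smul_right, inner_smul_left, h3,
    norm_smul, mul_pow, real_inner_self_eq_norm_sq, inner_smul_right]
  simp only [conj_trivial, Real.norm_eq_abs, sq_abs]
  ring

/-- The gradient v = Q (u - u_d) - B* l is itself used as a direction of variation. The first
variation vanishes, and duality between its state w (with w(0) = 0) and l (with l(T) = 0) turns this
into ∫ ‖v‖² = 0. -/
theorem IsOptimalTriple.control_eq {S : ℝ → X →L[ℝ] X} (hS : IsC0Semigroup S) {B : U →L[ℝ] X}
    {C : X →L[ℝ] V} {Q : U ≃L[ℝ] U} (hQ : (Q : U →L[ℝ] U).IsPositive) {y_d : X} {u_d : U}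
    {y₀ : X} {T : ℝ} (hT : 0 ≤ T) {y l : ℝ → X} {u : ℝ → U}
    (h : IsOptimalTriple S B C Q y_d u_d y₀ T y l u) :
    ∀ᵐ t ∂(volume.restrict (Ioc 0 T)), u t = u_d + Q.symm (B.adjoint (l t)) := by
  obtain ⟨⟨⟨hu, hy⟩, hopt⟩, hl⟩ := h
  set μ := volume.restrict (Ioc 0 T) with hμ
  have hprim : ∀ {f : ℝ → X}, MemLp f 2 μ → IntervalIntegrable f volume 0 T := fun hf => by
    rw [intervalIntegrable_iff_integrableOn_Ioc_of_le hT]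
    exact hf.integrable one_le_two
  have hQu : MemLp (fun t => Q (u t - u_d)) 2 μ :=
    (Q : U →L[ℝ] U).comp_memLp' (hu.sub (memLp_const u_d))
  have hBl : MemLp (fun t => B.adjoint (l t)) 2 μ :=
    memLp_of_continuousOn (B.adjoint.continuous.comp_continuousOn hl.1)
  set v : ℝ → U := fun t => Q (u t - u_d) - B.adjoint (l t) with hv_def
  have hv : MemLp v 2 μ := hQu.sub hBl
  have hBv : IntervalIntegrable (fun s => B (v s)) volume 0 T := hprim (B.comp_memLp' hv)
  have hBu : IntervalIntegrable (fun s => B (u s)) volume 0 T := hprim (B.comp_memLp' hu)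
  set w : ℝ → X := fun t => S t 0 + ∫ s in (0 : ℝ)..t, S (t - s) (B (v s))
  have hw : IsMildSolution S (fun s => B (v s)) 0 T w := hS.isMildSolution_conv hT hBv 0
  have hCw : MemLp (fun t => C (w t)) 2 μ :=
    memLp_of_continuousOn (C.continuous.comp_continuousOn hw.1)
  have hCy : MemLp (fun t => C (y t - y_d)) 2 μ :=
    memLp_of_continuousOn (C.continuous.comp_continuousOn (hy.1.sub continuousOn_const))
  set g : ℝ → X := fun s => C.adjoint (C (y s - y_d)) with hg_def
  have hgc : ContinuousOn g (Icc 0 T) := C.adjoint.continuous.comp_continuousOn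
    (C.continuous.comp_continuousOn (hy.1.sub continuousOn_const))
  have hi1 : Integrable (fun t => runningCost C Q y_d u_d (y t) (u t)) μ := by
    simp only [runningCost]
    exact (hCy.norm.integrable_sq.add
      (integrable_inner_of_memLp hQu (hu.sub (memLp_const u_d)))).const_mul _
  have hi2 : Integrable (fun t => inner ℝ (C (y t - y_d)) (C (w t))) μ :=
    integrable_inner_of_memLp hCy hCw
  have hi3 : Integrable (fun t => inner ℝ (Q (u t - u_d)) (v t)) μ :=
    integrable_inner_of_memLp hQu hv
  have hi4 : Integrable (fun t => (1 / 2 : ℝ) *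
      (inner ℝ (C (w t)) (C (w t)) + inner ℝ (Q (v t)) (v t))) μ :=
    ((integrable_inner_of_memLp hCw hCw).add
      (integrable_inner_of_memLp ((Q : U →L[ℝ] U).comp_memLp' hv) hv)).const_mul _
  have hfirst : (∫ t, inner ℝ (C (y t - y_d)) (C (w t)) ∂μ) +
      ∫ t, inner ℝ (Q (u t - u_d)) (v t) ∂μ = 0 := by
    refine eq_zero_of_forall_nonneg (b := ∫ t, (1 / 2 : ℝ) *
      (inner ℝ (C (w t)) (C (w t)) + inner ℝ (Q (v t)) (v t)) ∂μ) fun ε => ?_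
    have hadm : IsAdmissible S B y₀ T (fun t => y t + ε • w t) (fun t => u t + ε • v t) := by
      refine ⟨hu.add (hv.const_smul ε), ?_⟩
      simpa only [map_add, map_smul, smul_zero, add_zero] using hy.add_smul hS hBu hBv hw ε
    have hle := hopt _ _ hadm
    simp only [runningCost_add_smul hQ] at hle
    have hi23 : Integrable (fun t => ε * (inner ℝ (C (y t - y_d)) (C (w t)) +
        inner ℝ (Q (u t - u_d)) (v t))) μ := (hi2.add hi3).const_mul ε
    have hi24 := hi23.add (hi4.const_mul (ε ^ 2))
    simp only [Pi.add_def] at hi24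
    rw [intervalIntegral.integral_of_le hT, intervalIntegral.integral_of_le hT, ← hμ,
      integral_add hi1 hi24, integral_add hi23 (hi4.const_mul _), integral_const_mul,
      integral_const_mul, integral_add hi2 hi3] at hle
    linarith
  -- The boundary terms vanish, which leaves ∫ ⟨w, C*C (y - y_d)⟩ = -∫ ⟨B v, l⟩.
  have hdual := hw.inner_sub_inner hS hT hBv (ContinuousOn.intervalIntegrable_of_Icc hT
    (hgc.comp (by fun_prop) fun s hs => ⟨by linarith [hs.2], by linarith [hs.1]⟩ :
      ContinuousOn (g ∘ fun s => T - s) (Icc 0 T)).neg) hl.isMildSolution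
  have hrev : ∫ s in (0 : ℝ)..T, inner ℝ (w (T - s)) (g (T - s)) =
      ∫ s in (0 : ℝ)..T, inner ℝ (w s) (g s) := by
    have := intervalIntegral.integral_comp_sub_left (a := 0) (b := T)
      (fun s => inner ℝ (w s) (g s)) T
    simpa using this
  have hzero : ∫ t, inner ℝ (v t) (v t) ∂μ = 0 := by
    simp only [inner_zero_left, inner_zero_right, sub_zero, sub_sub_cancel, Pi.neg_apply,
      Function.comp_apply, inner_neg_right, intervalIntegral.integral_neg, sub_neg_eq_add,
      hrev] at hdual
    rw [intervalIntegral.integral_of_le hT, intervalIntegral.integral_of_le hT, ← hμ] at hdual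
    have e1 : ∀ t, inner ℝ (w t) (g t) = inner ℝ (C (y t - y_d)) (C (w t)) := fun t => by
      rw [hg_def, ContinuousLinearMap.adjoint_inner_right, real_inner_comm]
    have e2 : ∀ t, inner ℝ (v t) (v t) =
        inner ℝ (Q (u t - u_d)) (v t) - inner ℝ (B (v t)) (l t) := fun t => by
      rw [← ContinuousLinearMap.adjoint_inner_right, real_inner_comm (B.adjoint (l t)),
        ← inner_sub_left]
    have hi5 : Integrable (fun t => inner ℝ (B (v t)) (l t)) μ :=
      integrable_inner_of_memLp (B.comp_memLp' hv) (memLp_of_continuousOn hl.1)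
    simp only [e1] at hdual
    simp only [e2]
    rw [integral_sub hi3 hi5]
    linarith
  rw [integral_eq_zero_iff_of_nonneg (fun t => real_inner_self_nonneg)
    (integrable_inner_of_memLp hv hv)] at hzero
  filter_upwards [hzero] with t ht
  have hvt : v t = 0 := inner_self_eq_zero.1 ht
  rw [hv_def, sub_eq_zero] at hvt
  rw [← hvt, Q.symm_apply_apply, add_sub_cancel]

/-! ### Steady states as mild solutions -/

theorem isMildSolution_const {S : ℝ → X →L[ℝ] X} (hS : IsC0Semigroup S) {x z : X} (T : ℝ)
    (h : Tendsto (fun h : ℝ => h⁻¹ • (S h x - x)) (𝓝[>] 0) (𝓝 z)) :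
    IsMildSolution S (fun _ => -z) x T fun _ => x :=
  IsMildSolution.of_hasDeriv_right hS (q := fun _ => x) (a := fun _ => z) continuousOn_const
    continuousOn_const (fun _ _ => h) fun _ _ => by simp

/-- It is enough that the generator of `S` extends `A`; this is the form available for A* and S*, to
which detectability refers. -/
theorem ExponentiallyStabilizable.exists_feedback {A : X →ₗ.[ℝ] X} {S : ℝ → X →L[ℝ] X}
    (hS : IsC0Semigroup S)
    (hA : ∀ x : A.domain, Tendsto (fun h : ℝ => h⁻¹ • (S h x - x)) (𝓝[>] 0) (𝓝 (A x)))
    {B : U →L[ℝ] X} (h : ExponentiallyStabilizable A B) :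
    ∃ (K : X →L[ℝ] U) (R : ℝ → X →L[ℝ] X) (M ω : ℝ), 0 < M ∧ 0 < ω ∧
      (∀ t, 0 ≤ t → ‖R t‖ ≤ M * Real.exp (-ω * t)) ∧
      ∀ x T, IsMildSolution S (fun s => (B.comp K) (R s x)) x T fun s => R s x := by
  obtain ⟨K, R, hR, M, ω, hM, hω, hb⟩ := h
  refine ⟨K, R, M, ω, hM, hω, hb, hR.isMildSolution_of_perturbation hS (B.comp K) fun x => ?_⟩
  have : ((B.comp K : X →ₗ[ℝ] X) +ᵥ A) x - (B.comp K) x = A ⟨x, x.2⟩ := by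
    rw [LinearPMap.vadd_apply]
    exact add_sub_cancel_left _ _
  rw [this]
  exact hA ⟨x, x.2⟩

end LQTurnpike

/-! ### The turnpike estimate -/

theorem theorem2p3 {X U V : Type*}
    [NormedAddCommGroup X] [InnerProductSpace ℝ X] [CompleteSpace X]
    [NormedAddCommGroup U] [InnerProductSpace ℝ U] [CompleteSpace U]
    [NormedAddCommGroup V] [InnerProductSpace ℝ V] [CompleteSpace V]
    (A : X →ₗ.[ℝ] X) (S : ℝ → X →L[ℝ] X) (hAS : LQTurnpike.Generates A S)
    (B : U →L[ℝ] X) (C : X →L[ℝ] V)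
    (Q : U ≃L[ℝ] U) (hQ : (Q : U →L[ℝ] U).IsPositive)
    (hstab : LQTurnpike.ExponentiallyStabilizable A B)
    (hdet : LQTurnpike.ExponentiallyDetectable A C)
    (y_d : X) (u_d : U) :
    ∃ c ν : ℝ, 0 < c ∧ 0 < ν ∧
      ∀ (y_s l_s : X) (u_s : U),
        LQTurnpike.IsOptimalSteadyTriple A B C Q y_d u_d y_s l_s u_s →
      ∀ (y₀ : X) (T : ℝ), 0 < T →
      ∀ (y l : ℝ → X) (u : ℝ → U),
        LQTurnpike.IsOptimalTriple S B C Q y_d u_d y₀ T y l u →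
      ∀ᵐ t ∂(volume.restrict (Icc 0 T)),
        ‖y t - y_s‖ + ‖l t - l_s‖ + ‖u t - u_s‖ ≤
          c * (‖y₀ - y_s‖ + ‖l_s‖) * (Real.exp (-ν * t) + Real.exp (-ν * (T - t))) := by
  have hS := hAS.isC0Semigroup
  obtain ⟨α, hα, hαQ⟩ := LQTurnpike.exists_coercive Q hQ
  obtain ⟨K₁, R₁, M₁, ω₁, hM₁, hω₁, hR₁, hRS₁⟩ :=
    LQTurnpike.ExponentiallyStabilizable.exists_feedback hS.adjoint hAS.tendsto_adjoint_apply hdet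
  obtain ⟨K₂, R₂, M₂, ω₂, hM₂, hω₂, hR₂, hRS₂⟩ := hstab.exists_feedback hS hAS.tendsto_apply
  -- One pair of constants serves for both feedback semigroups.
  set M := max M₁ M₂
  set ω := min ω₁ ω₂
  have hM : 0 < M := lt_max_of_lt_left hM₁
  have hω : 0 < ω := lt_min hω₁ hω₂
  have hmono : ∀ M' ω' t : ℝ, M' ≤ M → ω ≤ ω' → 0 ≤ t →
      M' * Real.exp (-ω' * t) ≤ M * Real.exp (-ω * t) := fun M' ω' t h1 h2 h3 => by gcongr
  -- The sum of the four lower bounds required of γ.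
  set γ := (2 * ‖B‖ ^ 2 + 2 * (‖K₂‖ * ‖(Q : U →L[ℝ] U)‖) ^ 2) / α + 2 * ‖K₁‖ ^ 2 + 2 * ‖C‖ ^ 2
    with hγ
  have hγα : γ * α = 2 * ‖B‖ ^ 2 + 2 * (‖K₂‖ * ‖(Q : U →L[ℝ] U)‖) ^ 2 +
      (2 * ‖K₁‖ ^ 2 + 2 * ‖C‖ ^ 2) * α := by
    rw [hγ]; field_simp; ring
  have hrest : 0 ≤ (2 * ‖K₁‖ ^ 2 + 2 * ‖C‖ ^ 2) * α := by positivity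
  have hquot : 0 ≤ (2 * ‖B‖ ^ 2 + 2 * (‖K₂‖ * ‖(Q : U →L[ℝ] U)‖) ^ 2) / α := by positivity
  obtain ⟨c, ν, hc, hν, hbound⟩ := LQTurnpike.exists_decayPair_bound hM hω
    (by positivity : 0 ≤ M * (√γ * √(1 / (2 * ω))))
  set F : X →L[ℝ] U := (Q.symm : U →L[ℝ] U).comp B.adjoint
  -- Since u - u_s = F (l - l_s), the control costs the extra factor. The constants are fixed before
  -- the steady triple, y₀ and T.
  refine ⟨(1 + ‖F‖) * c, ν, by positivity, hν, ?_⟩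
  rintro y_s l_s u_s ⟨⟨⟨hys, hAys⟩, -⟩, ⟨hls, hAls⟩, hus⟩ y₀ T hT y l u hopt
  have hu := hopt.control_eq hS hQ hT.le
  obtain ⟨⟨⟨-, hy⟩, -⟩, hl⟩ := hopt
  have hFl : ContinuousOn (fun s => B (u_d + F (l s))) (Icc 0 T) :=
    B.continuous.comp_continuousOn (continuousOn_const.add (F.continuous.comp_continuousOn hl.1))
  -- The a.e. feedback law replaces the L² control by a continuous function of l.
  have hyF : LQTurnpike.IsMildSolution S (fun s => B (u_d + F (l s))) y₀ T y :=
    hy.congr_ae (by filter_upwards [hu] with s hs; rw [hs]; rfl)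
  have hys' := LQTurnpike.isMildSolution_const hS T (hAS.tendsto_apply ⟨y_s, hys⟩)
  have hls' := LQTurnpike.isMildSolution_const hS.adjoint T (hAS.tendsto_adjoint_apply ⟨l_s, hls⟩)
  have hx := hyF.sub hS (hFl.intervalIntegrable_of_Icc hT.le) intervalIntegrable_const hys'
  have hk : IntervalIntegrable (fun s => -C.adjoint (C (y (T - s) - y_d))) volume 0 T :=
    ContinuousOn.intervalIntegrable_of_Icc hT.le
      (C.adjoint.continuous.comp_continuousOn (C.continuous.comp_continuousOn
      ((hy.1.comp (by fun_prop) fun s hs => ⟨by linarith [hs.2], by linarith [hs.1]⟩).sub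
        continuousOn_const))).neg
  have hm := hl.isMildSolution.sub hS.adjoint hk intervalIntegrable_const hls'
  have hpair := LQTurnpike.decayPair_of_extremal (x := fun t => y t - y_s) (p := fun t => l t - l_s)
    (γ := γ) (T := T) (x₀ := y₀ - y_s) (m₀ := 0 - l_s) hS hα hαQ hM hω
    (by rw [hγα]; linarith [sq_nonneg (‖K₂‖ * ‖(Q : U →L[ℝ] U)‖)])
    (by linarith [sq_nonneg ‖C‖, hquot]) (by linarith [sq_nonneg ‖K₁‖, hquot])
    (by rw [hγα]; linarith [sq_nonneg ‖B‖])
    (fun t ht => (hR₁ t ht).trans (hmono _ _ t (le_max_left _ _) (min_le_left _ _) ht))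
    (fun t ht => (hR₂ t ht).trans (hmono _ _ t (le_max_right _ _) (min_le_right _ _) ht))
    -- The steady state contributes the forcing -A y_s = B u_s = B (u_d + F l_s), and the steady
    -- adjoint -A* l_s = -C*C (y_s - y_d); the targets cancel in the differences.
    hRS₁ hRS₂ (hl.1.sub continuousOn_const) (by
      convert hx using 2 with s
      rw [eq_neg_of_add_eq_zero_left hAys, neg_neg, ← map_sub, hus]
      congr 1
      change F (l s - l_s) = u_d + F (l s) - (u_d + F l_s)
      rw [map_sub, add_sub_add_left_eq_sub]) (by
      convert hm using 2 with s
      rw [sub_right_comm, sub_eq_zero] at hAls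
      rw [← hAls]
      simp only [map_sub]
      abel)
  have hdecay := hbound _ _ _ _ hpair
  have hlT : l T = 0 := by
    rw [hl.2 T ⟨hT.le, le_rfl⟩]; simp
  have hy0 : y 0 = y₀ := hy.apply_zero hS hT.le
  simp only [hlT, hy0, zero_sub, norm_neg] at hdecay
  rw [← Measure.restrict_congr_set Ioc_ae_eq_Icc]
  filter_upwards [hu, ae_restrict_mem measurableSet_Ioc] with t ht htT
  have h1 := hdecay t (Ioc_subset_Icc_self htT)
  have h2 : ‖u t - u_s‖ ≤ ‖F‖ * ‖l t - l_s‖ := by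
    rw [ht, hus, add_sub_add_left_eq_sub, ← map_sub, ← map_sub]
    exact F.le_opNorm _
  calc ‖y t - y_s‖ + ‖l t - l_s‖ + ‖u t - u_s‖
      ≤ (1 + ‖F‖) * (‖y t - y_s‖ + ‖l t - l_s‖) := by
        have : 0 ≤ ‖F‖ * ‖y t - y_s‖ := by positivity
        linarith
    _ ≤ (1 + ‖F‖) * (c * (‖y₀ - y_s‖ + ‖l_s‖) *
          (Real.exp (-ν * t) + Real.exp (-ν * (T - t)))) := by gcongr
    _ = _ := by ring
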